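/- Let $n\ge 2$ and let $Q(x_1,\dots,x_{n+2})=2x_1x_{n+2}+2x_2x_{n+1}+\sum_{i=3}^{n}x_i^2$, a quadratic form of signature $(n,2)$ on $\mathbb R^{n+2}$. Let $G=\mathrm{SO}^\circ(n,2)$ be the identity component of $\mathrm{SO}(Q)<\mathrm{SL}_{n+2}(\mathbb R)$, and let $H=\mathrm{SO}^\circ(n,1)$ be the identity component of $\{g\in G: gV=V\}$, where $V=\{x_1=x_{n+2}\}$. Let $K=\{g\in G: gg^T=1\}$, a maximal compact subgroup, and let $\mathfrak a$ be the space of diagonal matrices $v=\mathrm{diag}(v_1,v_2,0,\dots,0,-v_2,-v_1)$ with $v_1,v_2\in\mathbb R$. Let $\mathfrak a^+\subset\mathfrak a$ be the closed positive Weyl chamber, that is, $\{v_1\ge v_2\ge 0\}$ if $n\ge 3$ and $\{v_1\ge |v_2|\}$ if $n=2$. For $g\in G$ let $\mu(g)\in\mathfrak a^+$ be the Cartan projection, the unique element of $\mathfrak a^+$ with $g\in K\exp(\mu(g))K$. Let $\rho$ be the half-sum of the positive roots of $(\mathrm{Lie}\,G,\mathfrak a)$ counted with multiplicity (explicitly,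 $\rho(v)=\tfrac12(nv_1+(n-2)v_2)$). Fix any norm $\|\cdot\|$ on $\mathfrak a$. For a discrete subgroup $\Gamma<G$, the growth indicator $\psi_\Gamma:\mathfrak a^+\to\mathbb R\cup\{-\infty\}$ is $$\psi_\Gamma(v)=\|v\|\cdot\inf_{v\in\mathcal C}\ \limsup_{T\to\infty}\frac{\log\#\{\gamma\in\Gamma:\mu(\gamma)\in\mathcal C,\ \|\mu(\gamma)\|\le T\}}{T},$$ where the infimum is over all relatively open cones $\mathcal C\subset\mathfrak a^+$ containing $v$, $\log 0=-\infty$, and $\psi_\Gamma(0)=0$. Let $\Gamma<G$ be a discrete subgroup that is contained in $H$ and is a lattice in $H$. Then $\mu(H)$ is the ray $\{v\in\mathfrak a: v_1\ge 0,\ v_2=0\}$, and for $v\in\mathfrak a^+$ $$\psi_\Gamma(v)=\begin{cases}(n-1)\,v_1 & \text{if } v\in\mu(H),\\ -\infty & \text{if } v\notin\mu(H).\end{cases}$$ Consequently $\psi_\Gamma\le \frac{2(n-1)}{n}\,\rho$ on $\mathfrak a^+$, with equality on $\mu(H)$. -/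

import Mathlib

open MeasureTheory Filter
open scoped Matrix ENNReal

noncomputable section

namespace SOn2

/-- The quadratic form `Q(x₁, …, xₙ₊₂) = 2 x₁ xₙ₊₂ + 2 x₂ xₙ₊₁ + ∑_{i=3}^{n} xᵢ²` of signature
`(n, 2)` on `ℝⁿ⁺²`. The coordinate `xᵢ` has index `i - 1` in `Fin (n + 2)`. -/
def Q (n : ℕ) : QuadraticForm ℝ (Fin (n + 2) → ℝ) :=
  (2 : ℝ) • QuadraticMap.proj 0 (Fin.last (n + 1))
    + (2 : ℝ) • QuadraticMap.proj 1 ⟨n, by omega⟩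
    + ∑ i : Fin (n + 2) with 2 ≤ i.val ∧ i.val < n, QuadraticMap.proj i i

/-- `SO(Q)`, the elements of `SL(n + 2, ℝ)` that preserve `Q`. -/
def SOQ (n : ℕ) : Subgroup (Matrix.SpecialLinearGroup (Fin (n + 2)) ℝ) where
  carrier := {g | ∀ x, Q n (g.1 *ᵥ x) = Q n x}
  one_mem' x := by simp
  mul_mem' {a b} ha hb x := by
    have := ha (b.1 *ᵥ x)
    rw [Matrix.mulVec_mulVec] at this
    simpa [hb x] using this
  inv_mem' {a} ha x := by
    have h := ha ((a⁻¹).1 *ᵥ x)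
    have e : a.1 * (a⁻¹).1 = 1 := by
      rw [← Matrix.SpecialLinearGroup.coe_mul, mul_inv_cancel, Matrix.SpecialLinearGroup.coe_one]
    rw [Matrix.mulVec_mulVec, e, Matrix.one_mulVec] at h
    exact h.symm

/-- The identity component of a subgroup `L` (in the subspace topology), as a subgroup of the
ambient group. -/
def identityComponent {S : Type*} [Group S] [TopologicalSpace S] [IsTopologicalGroup S]
    (L : Subgroup S) : Subgroup S :=
  (Subgroup.connectedComponentOfOne L).map L.subtype

/-- `G = SO°(n, 2)`. -/
def G (n : ℕ) : Subgroup (Matrix.SpecialLinearGroup (Fin (n + 2)) ℝ) :=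
  identityComponent (SOQ n)

/-- The hyperplane `V = {x₁ = xₙ₊₂}`; the restriction of `Q` to it has signature `(n, 1)`. -/
def V (n : ℕ) : Submodule ℝ (Fin (n + 2) → ℝ) where
  carrier := {x | x 0 = x (Fin.last (n + 1))}
  add_mem' {a b} ha hb := by
    simp only [Set.mem_ofPred_eq, Pi.add_apply] at *
    rw [ha, hb]
  zero_mem' := rfl
  smul_mem' c x hx := by
    simp only [Set.mem_ofPred_eq, Pi.smul_apply] at *
    rw [hx]

/-- `{g ∈ G : g V = V}`. -/
def stabV (n : ℕ) : Subgroup (Matrix.SpecialLinearGroup (Fin (n + 2)) ℝ) where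
  carrier := {g | g ∈ G n ∧ (V n).map g.1.mulVecLin = V n}
  one_mem' := ⟨one_mem _, by simp⟩
  mul_mem' {a b} ha hb := by
    refine ⟨mul_mem ha.1 hb.1, ?_⟩
    rw [Matrix.SpecialLinearGroup.coe_mul, Matrix.mulVecLin_mul, Submodule.map_comp, hb.2, ha.2]
  inv_mem' {a} ha := by
    refine ⟨inv_mem ha.1, ?_⟩
    have e : (a⁻¹).1 * a.1 = 1 := by
      rw [← Matrix.SpecialLinearGroup.coe_mul, inv_mul_cancel, Matrix.SpecialLinearGroup.coe_one]
    conv_lhs => rw [← ha.2]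
    rw [← Submodule.map_comp, ← Matrix.mulVecLin_mul, e, Matrix.mulVecLin_one, Submodule.map_id]

/-- `H = SO°(n, 1)`, the identity component of the stabilizer of `V` in `G`. It acts on `V` as
`SO°(Q|_V)` and fixes the `Q`-orthogonal line of `V` pointwise. -/
def H (n : ℕ) : Subgroup (Matrix.SpecialLinearGroup (Fin (n + 2)) ℝ) :=
  identityComponent (stabV n)

/-- The maximal compact subgroup `K = {g ∈ G : g gᵀ = 1} = G ∩ SO(n + 2)`. -/
def K (n : ℕ) : Set (Matrix.SpecialLinearGroup (Fin (n + 2)) ℝ) :=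
  {g | g ∈ G n ∧ g.1 * g.1ᵀ = 1}

/-- The Cartan subspace `𝔞` is identified with `ℝ × ℝ`: the pair `v = (v₁, v₂)` stands for the
vector `(v₁, v₂, 0, …, 0, -v₂, -v₁)`, that is, for the diagonal matrix with these entries. -/
def aVec (n : ℕ) (v : ℝ × ℝ) : Fin (n + 2) → ℝ := fun i =>
  if i.val = 0 then v.1
  else if i.val = 1 then v.2
  else if i.val = n then -v.2
  else if i.val = n + 1 then -v.1
  else 0

/-- The closed positive Weyl chamber `𝔞⁺`. It is `{v₁ ≥ v₂ ≥ 0}` if `n ≥ 3`. If `n = 2`, then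
`v ↦ v₂` is not a root, and the chamber is `{v₁ ≥ |v₂|}`. -/
def aplus (n : ℕ) : Set (ℝ × ℝ) :=
  {v | |v.2| ≤ v.1 ∧ (n ≠ 2 → 0 ≤ v.2)}

/-- `v ∈ 𝔞⁺` and `g ∈ K exp(v) K`. -/
def IsCartanProj (n : ℕ) (g : Matrix.SpecialLinearGroup (Fin (n + 2)) ℝ) (v : ℝ × ℝ) : Prop :=
  v ∈ aplus n ∧ ∃ k ∈ K n, ∃ l ∈ K n,
    g.1 = k.1 * Matrix.diagonal (fun i => Real.exp (aVec n v i)) * l.1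

/-- The Cartan projection `μ`: for `g ∈ G`, the unique `μ(g) ∈ 𝔞⁺` with `g ∈ K exp(μ(g)) K`. -/
def cartanProj (n : ℕ) (g : Matrix.SpecialLinearGroup (Fin (n + 2)) ℝ) : ℝ × ℝ :=
  Classical.epsilon (IsCartanProj n g)

/-- `C` is a cone contained in `𝔞⁺` that is open in `𝔞⁺`. -/
def IsOpenCone (n : ℕ) (C : Set (ℝ × ℝ)) : Prop :=
  (∃ U : Set (ℝ × ℝ), IsOpen U ∧ C = aplus n ∩ U) ∧ ∀ x ∈ C, ∀ t : ℝ, 0 < t → t • x ∈ C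

/-- The growth indicator of `Γ`, computed with the norm `N` on `𝔞`:
`ψ_Γ(v) = N(v) · inf_{C ∋ v} limsup_{T → ∞} (log #{γ ∈ Γ : μ(γ) ∈ C, N(μ(γ)) ≤ T}) / T`
for `v ∈ 𝔞⁺`, with `log 0 = -∞`. -/
def growthIndicator (n : ℕ) (N : Seminorm ℝ (ℝ × ℝ))
    (Γ : Subgroup (Matrix.SpecialLinearGroup (Fin (n + 2)) ℝ)) (v : ℝ × ℝ) : EReal :=
  (N v : EReal) * ⨅ (C : Set (ℝ × ℝ)) (_ : IsOpenCone n C ∧ v ∈ C),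
    limsup (fun T : ℝ =>
      ENNReal.log (({γ | γ ∈ Γ ∧ cartanProj n γ ∈ C ∧ N (cartanProj n γ) ≤ T}.encard : ℕ∞) : ℝ≥0∞)
        / (T : EReal)) atTop

/-- The root space in `𝔤 = 𝔰𝔬(Q)` of a linear form `α` on `𝔞`: the matrices `X` in `𝔤`, i.e. with
`B(x, X x) = 0` for all `x`, where `B` is the symmetric bilinear form of `Q`,
such that `[v, X] = α(v) X` for all `v ∈ 𝔞`. -/
def rootSpace (n : ℕ) (α : (ℝ × ℝ) →ₗ[ℝ] ℝ) :
    Submodule ℝ (Matrix (Fin (n + 2)) (Fin (n + 2)) ℝ) where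
  carrier := {X | (∀ x, (Q n).polarBilin x (X *ᵥ x) = 0) ∧
    ∀ v : ℝ × ℝ, Matrix.diagonal (aVec n v) * X - X * Matrix.diagonal (aVec n v) = α v • X}
  add_mem' {X Y} hX hY := by
    refine ⟨fun x => ?_, fun v => ?_⟩
    · rw [Matrix.add_mulVec, map_add, hX.1, hY.1, add_zero]
    · rw [mul_add, add_mul, smul_add, ← hX.2 v, ← hY.2 v]; abel
  zero_mem' := ⟨fun x => by rw [Matrix.zero_mulVec, map_zero], fun v => by simp⟩
  smul_mem' c X hX := by
    refine ⟨fun x => ?_, fun v => ?_⟩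
    · rw [Matrix.smul_mulVec, map_smul, hX.1, smul_zero]
    · rw [Matrix.mul_smul, Matrix.smul_mul, ← smul_sub, hX.2 v, smul_comm]

/-- The half-sum `ρ` of the positive roots of `(𝔤, 𝔞)`, counted with multiplicity; a root is
positive if it is nonnegative on `𝔞⁺`. Linear forms that are not roots have multiplicity `0`. -/
def rho (n : ℕ) (v : ℝ × ℝ) : ℝ :=
  (1 / 2) * ∑ᶠ α ∈ {α : (ℝ × ℝ) →ₗ[ℝ] ℝ | α ≠ 0 ∧ ∀ w ∈ aplus n, 0 ≤ α w},
    (Module.finrank ℝ (rootSpace n α) : ℝ) * α v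

/-- `Γ` is a lattice in the topological group `L`: it is discrete, and `Γ \ L` has finite volume,
i.e. the left action of `Γ` on `L` has a fundamental domain of finite Haar measure. -/
def IsLattice {L : Type*} [Group L] [TopologicalSpace L] (Γ : Subgroup L) : Prop :=
  DiscreteTopology Γ ∧
    letI : MeasurableSpace L := borel L
    ∃ m : Measure L, m.IsHaarMeasure ∧ ∃ F : Set L, IsFundamentalDomain Γ F m ∧ m F < ∞

end SOn2

end

/-! The group `H` preserves `V` and fixes its orthogonal line, so it acts on the hyperbolic space
of vectors of `V` with `Q = -2`, and `h ∈ H` moves the base point `e₂ - eₙ₊₁` by a distance `d(h)`.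
Rotating in the stabilizer of the base point gives `H = (H ∩ K) exp (0, t) (H ∩ K)` with
`t = d(h)`. An element of `K` that exchanges the two coordinates of `𝔞` turns `(0, t)` into
`(t, 0)`, hence `μ(h) = (d(h), 0)`. The growth indicator is therefore `-∞` off the ray `v₂ = 0`,
and on it the claim is that `#{γ ∈ Γ : d(γ) ≤ T}` grows like `exp ((n - 1) T)` up to
subexponential factors.

Upper bound: orbit points within distance `T` are sorted by cells of bounded diameter in the upper
half space model. There are about `T exp ((n - 1) T)` of these, and a discrete group has boundedly
many points in each.

Lower bound: the geodesic flow preserves the finite measure on `Γ \ H`, so by Poincaré recurrence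
the measures of the returns to a small set have a divergent sum over the times `k`. The return at
time `k` is a union of pieces indexed by the `γ ∈ Γ` with `d(γ) ≤ k + O(1)`. Each piece has measure
`O(exp (-(n - 1) k))`, since the flow contracts the horospherical subgroup, of dimension `n - 1`,
and the corresponding translates of the piece are disjoint. With fewer than `exp (s T)` lattice
points for some `s < n - 1` and all large `T`, the sum would converge.
-/

noncomputable section

namespace SOn2

section Recurrence

lemma tsum_measure_inter_preimage_iterate_eq_top {α : Type*} [MeasurableSpace α] {μ : Measure α}
    {f : α → α} (hf : Conservative f μ) {s : Set α} (hs : NullMeasurableSet s μ) (h0 : μ s ≠ 0) :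
    ∑' k, μ (s ∩ f^[k] ⁻¹' s) = ∞ := by
  by_contra hsum
  refine h0 (measure_eq_zero_iff_ae_notMem.2 ?_)
  filter_upwards [hf.ae_mem_imp_frequently_image_mem hs, ae_eventually_notMem hsum]
    with x hreturn hescape hx
  obtain ⟨k, hk, hk'⟩ := ((hreturn hx).and_eventually hescape).exists
  exact hk' ⟨hx, hk⟩

section Quotient

open scoped Pointwise

variable {Γ α : Type*} [Group Γ] [MulAction Γ α]

/-- The map induced on the space of orbits by an equivariant map. -/
def orbitMap (f : α → α) (hf : ∀ (γ : Γ) x, f (γ • x) = γ • f x) :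
    Quotient (MulAction.orbitRel Γ α) → Quotient (MulAction.orbitRel Γ α) :=
  Quotient.map f (by
    rintro x y ⟨γ, rfl⟩
    exact ⟨γ, (hf γ y).symm⟩)

lemma iterate_orbitMap_mk {f : α → α} (hf : ∀ (γ : Γ) x, f (γ • x) = γ • f x) (k : ℕ) (x : α) :
    (orbitMap f hf)^[k] ⟦x⟧ = ⟦f^[k] x⟧ :=
  (Function.Semiconj.iterate_right (f := Quotient.mk (MulAction.orbitRel Γ α)) (ga := f)
    (gb := orbitMap f hf) (fun _ ↦ rfl) k x).symm

lemma preimage_mk_image_mk (U : Set α) :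
    Quotient.mk (MulAction.orbitRel Γ α) ⁻¹' (Quotient.mk _ '' U) = ⋃ γ : Γ, γ • U :=
  MulAction.quotient_preimage_image_eq_union_mul U

variable [Countable Γ] [MeasurableSpace α] [MeasurableConstSMul Γ α]

lemma measurableSet_image_mk {U : Set α} (hU : MeasurableSet U) :
    MeasurableSet (Quotient.mk (MulAction.orbitRel Γ α) '' U) := by
  rw [measurableSet_quotient, Quotient.mk''_eq_mk, preimage_mk_image_mk]
  exact .iUnion fun γ ↦ hU.const_smul γ

variable {m : Measure α} [SMulInvariantMeasure Γ α m] {F : Set α}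

/-- The measure induced by `m` on the space of orbits of `Γ`, by means of a fundamental domain. -/
def orbitMeasure (Γ : Type*) [Group Γ] [MulAction Γ α] (m : Measure α) (F : Set α) :
    Measure (Quotient (MulAction.orbitRel Γ α)) :=
  (m.restrict F).map (Quotient.mk _)

lemma measurePreserving_orbitMap (hF : IsFundamentalDomain Γ F m) {e : α ≃ᵐ α}
    (he : ∀ (γ : Γ) x, e (γ • x) = γ • e x) (hm : MeasurePreserving e m m) :
    MeasurePreserving (orbitMap e he) (orbitMeasure Γ m F) (orbitMeasure Γ m F) := by
  have hπ : Measurable (Quotient.mk (MulAction.orbitRel Γ α)) := measurable_quotient_mk''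
  have hmap : Measurable (orbitMap e he) :=
    measurable_from_quotient.2 (hπ.comp e.measurable)
  have hF' : IsFundamentalDomain Γ (e.symm ⁻¹' F) m := by
    refine hF.preimage_of_equiv (hm.symm e).quasiMeasurePreserving (e := id)
      Function.bijective_id fun γ x ↦ ?_
    rw [e.symm_apply_eq, he, e.apply_symm_apply, id]
  have hrestrict : (m.restrict F).map e = m.restrict (e.symm ⁻¹' F) := by
    have h := (hm.restrict_preimage_emb e.measurableEmbedding (e.symm ⁻¹' F)).map_eq
    rwa [← Set.preimage_comp, e.symm_comp_self, Set.preimage_id] at h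
  refine ⟨hmap, ?_⟩
  calc (orbitMeasure Γ m F).map (orbitMap e he)
      = ((m.restrict F).map e).map (Quotient.mk _) := by
        rw [orbitMeasure, Measure.map_map hmap hπ, Measure.map_map hπ e.measurable]
        rfl
    _ = orbitMeasure Γ m F := by
        rw [hrestrict]
        exact hF'.quotientMeasure_eq _ hF

lemma orbitMeasure_le (hF : IsFundamentalDomain Γ F m)
    {A : Set (Quotient (MulAction.orbitRel Γ α))} (hA : MeasurableSet A) {B : Set α}
    (h : A ⊆ Quotient.mk _ '' B) : orbitMeasure Γ m F A ≤ m B := by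
  rw [orbitMeasure, measure_map_restrict_apply m F hA, hF.measure_eq_tsum B]
  refine (measure_mono ?_).trans (measure_iUnion_le _)
  rw [← Set.iUnion_inter, ← preimage_mk_image_mk]
  exact Set.inter_subset_inter_left _ (Set.preimage_mono h)

lemma orbitMeasure_image_ne_zero (hF : IsFundamentalDomain Γ F m) {U : Set α}
    (hU : MeasurableSet (Quotient.mk (MulAction.orbitRel Γ α) '' U)) (hU0 : m U ≠ 0) :
    orbitMeasure Γ m F (Quotient.mk _ '' U) ≠ 0 := by
  rw [orbitMeasure, measure_map_restrict_apply m F hU]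
  refine fun h0 ↦ hU0 (measure_mono_null
    (Set.subset_preimage_image (Quotient.mk (MulAction.orbitRel Γ α)) U) ?_)
  refine hF.measure_zero_of_invariant _ (fun γ ↦ ?_) h0
  rw [preimage_mk_image_mk, Set.smul_set_iUnion]
  simp only [smul_smul]
  exact (Group.mulLeft_bijective γ).surjective.iUnion_comp fun γ' ↦ γ' • U

lemma tsum_measure_return_eq_top (hF : IsFundamentalDomain Γ F m) (hfin : m F < ∞) {e : α ≃ᵐ α}
    (he : ∀ (γ : Γ) x, e (γ • x) = γ • e x) (hm : MeasurePreserving e m m) {U : Set α}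
    (hU : MeasurableSet U) (hU0 : m U ≠ 0) :
    ∑' k : ℕ, m {x ∈ U | ∃ γ : Γ, γ • e^[k] x ∈ U} = ∞ := by
  have : IsFiniteMeasure (m.restrict F) := isFiniteMeasure_restrict.2 hfin.ne
  have : IsFiniteMeasure (orbitMeasure Γ m F) := by unfold orbitMeasure; infer_instance
  have hS := measurableSet_image_mk (Γ := Γ) hU
  have hT := measurePreserving_orbitMap hF he hm
  refine top_unique ?_
  rw [← tsum_measure_inter_preimage_iterate_eq_top hT.conservative hS.nullMeasurableSet
    (orbitMeasure_image_ne_zero hF hS hU0)]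
  refine ENNReal.tsum_le_tsum fun k ↦ orbitMeasure_le hF (hS.inter (hT.measurable.iterate k hS)) ?_
  rintro _ ⟨⟨x, hx, rfl⟩, y, hy, hyx⟩
  rw [iterate_orbitMap_mk] at hyx
  obtain ⟨γ, hγ⟩ := Quotient.exact hyx
  exact ⟨x, ⟨hx, γ, by rwa [← hγ] at hy⟩, rfl⟩

end Quotient

variable {L : Type*} [Group L] [TopologicalSpace L] [IsTopologicalGroup L]
  [LocallyCompactSpace L] [SecondCountableTopology L] [MeasurableSpace L] [BorelSpace L]
  {Γ : Subgroup L} [Countable Γ] {m : Measure L} [m.IsHaarMeasure] {F : Set L}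

lemma measurePreserving_mul_right_of_isFundamentalDomain (hF : IsFundamentalDomain Γ F m)
    (hfin : m F < ∞) (a : L) : MeasurePreserving (· * a) m m := by
  have hF' : IsFundamentalDomain Γ ((· * a) ⁻¹' F) m :=
    hF.preimage_of_equiv (quasiMeasurePreserving_mul_right m a) (e := id) Function.bijective_id
      fun γ x ↦ mul_assoc (γ : L) x a
  set c := Measure.haarScalarFactor (m.map (· * a)) m
  have hmap : m.map (· * a) = c • m := Measure.isMulLeftInvariant_eq_smul _ _
  have hcF : (c : ℝ≥0∞) * m F = m F := by
    rw [← smul_eq_mul, ← ENNReal.smul_def, ← Measure.smul_apply, ← hmap]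
    exact ((MeasurableEquiv.mulRight a).map_apply F).trans (hF'.measure_eq hF)
  have hc : (c : ℝ≥0∞) = 1 :=
    (ENNReal.mul_eq_right (hF.measure_ne_zero (NeZero.ne m)) hfin.ne).1 hcF
  refine ⟨measurable_mul_const a, ?_⟩
  rw [hmap, ENNReal.coe_eq_one.1 hc, one_smul]

lemma tsum_measure_mul_pow_return_eq_top (hF : IsFundamentalDomain Γ F m) (hfin : m F < ∞) (a : L)
    {U : Set L} (hU : MeasurableSet U) (hU0 : m U ≠ 0) :
    ∑' k : ℕ, m {x ∈ U | ∃ γ : Γ, (γ : L) * (x * a ^ k) ∈ U} = ∞ := by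
  have h := tsum_measure_return_eq_top hF hfin (e := MeasurableEquiv.mulRight a)
    (fun γ x ↦ mul_assoc (γ : L) x a)
    (measurePreserving_mul_right_of_isFundamentalDomain hF hfin a) hU hU0
  simpa only [MeasurableEquiv.coe_mulRight, mul_right_iterate, Subgroup.smul_def, smul_eq_mul]
    using h

end Recurrence

open Matrix

/-! ### Matrices and bilinear forms -/

section Matrices

variable {ι : Type*} [Fintype ι]

lemma dotProduct_mulVec_mulVec (g M : Matrix ι ι ℝ) (x y : ι → ℝ) :
    (g *ᵥ x) ⬝ᵥ (M *ᵥ (g *ᵥ y)) = x ⬝ᵥ ((gᵀ * M * g) *ᵥ y) := by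
  rw [← mulVec_mulVec, ← mulVec_mulVec, dotProduct_mulVec x, vecMul_transpose]

lemma transpose_mul_mul_mul_mul {A B M : Matrix ι ι ℝ} (hA : Aᵀ * M * A = M) (hB : Bᵀ * M * B = M) :
    (A * B)ᵀ * M * (A * B) = M := by
  calc (A * B)ᵀ * M * (A * B) = Bᵀ * (Aᵀ * M * A) * B := by
        simp only [transpose_mul, Matrix.mul_assoc]
    _ = M := by rw [hA, hB]

lemma eq_of_dotProduct_mulVec_eq {A B : Matrix ι ι ℝ}
    (h : ∀ x y, x ⬝ᵥ (A *ᵥ y) = x ⬝ᵥ (B *ᵥ y)) : A = B := by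
  classical
  exact ext_of_mulVec_single fun j ↦ dotProduct_eq _ _ fun x ↦ by
    rw [dotProduct_comm, h, dotProduct_comm]

variable [DecidableEq ι]

lemma SL.coe_inv_mul (g : SpecialLinearGroup ι ℝ) : (g⁻¹).1 * g.1 = 1 :=
  congrArg Subtype.val (inv_mul_cancel g)

lemma SL.coe_mul_inv (g : SpecialLinearGroup ι ℝ) : g.1 * (g⁻¹).1 = 1 :=
  congrArg Subtype.val (mul_inv_cancel g)

lemma SL.mul_mulVec (g h : SpecialLinearGroup ι ℝ) (x : ι → ℝ) :
    (g * h).1 *ᵥ x = g.1 *ᵥ (h.1 *ᵥ x) :=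
  (mulVec_mulVec x g.1 h.1).symm

@[simp]
lemma SL.inv_mulVec_mulVec (g : SpecialLinearGroup ι ℝ) (x : ι → ℝ) :
    (g⁻¹).1 *ᵥ (g.1 *ᵥ x) = x := by
  rw [mulVec_mulVec, SL.coe_inv_mul, one_mulVec]

@[simp]
lemma SL.mulVec_inv_mulVec (g : SpecialLinearGroup ι ℝ) (x : ι → ℝ) :
    g.1 *ᵥ ((g⁻¹).1 *ᵥ x) = x := by
  rw [mulVec_mulVec, SL.coe_mul_inv, one_mulVec]

lemma SL.inv_mulVec_of_mulVec_eq {g : SpecialLinearGroup ι ℝ} {x : ι → ℝ} (h : g.1 *ᵥ x = x) :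
    (g⁻¹).1 *ᵥ x = x := by
  conv_lhs => rw [← h, SL.inv_mulVec_mulVec]

end Matrices

/-! ### The Gram matrix of `Q` -/

variable {n : ℕ}

variable (n) in
/-- The permutation `σ` of the indices with `Q x = ∑ i, x i * x (σ i)`. -/
def dual : Equiv.Perm (Fin (n + 2)) :=
  Equiv.swap 0 (Fin.last (n + 1)) * Equiv.swap 1 ⟨n, by omega⟩

variable (n) in
/-- The Gram matrix of `Q`. -/
def J : Matrix (Fin (n + 2)) (Fin (n + 2)) ℝ := (dual n).permMatrix ℝ

lemma J_mulVec (x : Fin (n + 2) → ℝ) : J n *ᵥ x = x ∘ dual n :=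
  permMatrix_mulVec _

lemma J_mulVec_apply (x : Fin (n + 2) → ℝ) (i : Fin (n + 2)) : (J n *ᵥ x) i = x (dual n i) := by
  rw [J_mulVec, Function.comp_apply]

lemma index_cases (i : Fin (n + 2)) :
    i = 0 ∨ i = Fin.last (n + 1) ∨ i = 1 ∨ i = ⟨n, by omega⟩ ∨ (2 ≤ i.val ∧ i.val < n) := by
  simp only [Fin.ext_iff, Fin.val_zero, Fin.val_last, Fin.val_one]
  omega

variable [hn : n.AtLeastTwo]

lemma dual_zero : dual n 0 = Fin.last (n + 1) := by
  have := hn.prop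
  simp [dual, Equiv.swap_apply_def, Fin.ext_iff]; omega

lemma dual_one : dual n 1 = ⟨n, by omega⟩ := by
  have := hn.prop
  simp [dual, Equiv.swap_apply_def, Fin.ext_iff]; omega

lemma dual_last : dual n (Fin.last (n + 1)) = 0 := by
  have h1 : Fin.last (n + 1) ≠ 1 := by have := hn.prop; simp [Fin.ext_iff]; omega
  have hpen : Fin.last (n + 1) ≠ ⟨n, by omega⟩ := by simp [Fin.ext_iff]
  rw [dual, Equiv.Perm.mul_apply, Equiv.swap_apply_of_ne_of_ne h1 hpen, Equiv.swap_apply_right]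

lemma dual_penultimate : dual n ⟨n, by omega⟩ = 1 := by
  have := hn.prop
  simp [dual, Equiv.swap_apply_def, Fin.ext_iff]; omega

omit hn in
lemma dual_of_middle {i : Fin (n + 2)} (h : 2 ≤ i.val ∧ i.val < n) : dual n i = i := by
  have hne : ∀ j : Fin (n + 2), j.val < 2 ∨ n ≤ j.val → i ≠ j := by grind
  rw [dual, Equiv.Perm.mul_apply, Equiv.swap_apply_of_ne_of_ne (hne 1 (by simp)) (hne _ (by simp)),
    Equiv.swap_apply_of_ne_of_ne (hne 0 (by simp)) (hne _ (by simp))]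

@[simp]
lemma dual_dual (i : Fin (n + 2)) : dual n (dual n i) = i := by
  rcases index_cases i with rfl | rfl | rfl | rfl | h
  · rw [dual_zero, dual_last]
  · rw [dual_last, dual_zero]
  · rw [dual_one, dual_penultimate]
  · rw [dual_penultimate, dual_one]
  · rw [dual_of_middle h, dual_of_middle h]

lemma dual_eq_iff {i j : Fin (n + 2)} : dual n i = j ↔ i = dual n j :=
  (Function.Involutive.eq_iff dual_dual)

lemma inv_dual : (dual n)⁻¹ = dual n :=
  inv_eq_of_mul_eq_one_left (Equiv.ext dual_dual)

lemma transpose_J : (J n)ᵀ = J n := by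
  rw [J, transpose_permMatrix, inv_dual]

@[simp]
lemma J_mulVec_J_mulVec (x : Fin (n + 2) → ℝ) : J n *ᵥ (J n *ᵥ x) = x :=
  funext fun i ↦ by rw [J_mulVec_apply, J_mulVec_apply, dual_dual]

lemma J_mul_J : J n * J n = 1 :=
  ext_of_mulVec_single fun i ↦ by rw [← mulVec_mulVec, one_mulVec, J_mulVec_J_mulVec]

lemma J_single (i : Fin (n + 2)) : J n *ᵥ Pi.single i 1 = Pi.single (dual n i) 1 := by
  ext j
  simp only [J_mulVec_apply, Pi.single_apply, dual_eq_iff]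

lemma dotProduct_J_comm (x y : Fin (n + 2) → ℝ) : x ⬝ᵥ (J n *ᵥ y) = (J n *ᵥ x) ⬝ᵥ y := by
  rw [dotProduct_mulVec, ← mulVec_transpose, transpose_J]

lemma J_dotProduct_J (x y : Fin (n + 2) → ℝ) : (J n *ᵥ x) ⬝ᵥ (J n *ᵥ y) = x ⬝ᵥ y := by
  rw [← dotProduct_J_comm, J_mulVec_J_mulVec]

lemma sum_eq_sum_ends_add_sum_middle (g : Fin (n + 2) → ℝ) :
    ∑ i, g i = g 0 + g (Fin.last (n + 1)) + g 1 + g ⟨n, by omega⟩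
      + ∑ i : Fin (n + 2) with 2 ≤ i.val ∧ i.val < n, g i := by
  have := hn.prop
  have huniv : (Finset.univ : Finset (Fin (n + 2))) =
      insert 0 (insert (Fin.last (n + 1)) (insert 1 (insert ⟨n, by omega⟩
        (Finset.univ.filter fun i : Fin (n + 2) ↦ 2 ≤ i.val ∧ i.val < n)))) := by
    ext i
    simpa using index_cases i
  rw [huniv, Finset.sum_insert, Finset.sum_insert, Finset.sum_insert, Finset.sum_insert, ← huniv]
  · ring
  all_goals
    simp only [Finset.mem_insert, Finset.mem_filter, Finset.mem_univ, true_and, Fin.ext_iff,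
      Fin.val_zero, Fin.val_last, Fin.val_one]
    omega

lemma Q_apply (x : Fin (n + 2) → ℝ) : Q n x = x ⬝ᵥ (J n *ᵥ x) := by
  have hmiddle : ∑ i : Fin (n + 2) with 2 ≤ i.val ∧ i.val < n, x i * x (dual n i)
      = ∑ i : Fin (n + 2) with 2 ≤ i.val ∧ i.val < n, x i * x i :=
    Finset.sum_congr rfl fun i hi ↦ by rw [dual_of_middle (Finset.mem_filter.1 hi).2]
  simp only [dotProduct, J_mulVec_apply, sum_eq_sum_ends_add_sum_middle, dual_zero, dual_last,
    dual_one, dual_penultimate, hmiddle, Q, _root_.add_apply, _root_.smul_apply,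
    QuadraticMap.proj_apply, _root_.sum_apply, smul_eq_mul]
  ring

lemma polarBilin_Q_apply (x y : Fin (n + 2) → ℝ) :
    (Q n).polarBilin x y = 2 * (x ⬝ᵥ (J n *ᵥ y)) := by
  have hsymm : y ⬝ᵥ (J n *ᵥ x) = x ⬝ᵥ (J n *ᵥ y) := by rw [dotProduct_J_comm, dotProduct_comm]
  rw [QuadraticMap.polarBilin_apply_apply, QuadraticMap.polar, Q_apply, Q_apply, Q_apply,
    mulVec_add, add_dotProduct, dotProduct_add, dotProduct_add, hsymm]
  ring

lemma mem_SOQ_iff (g : SpecialLinearGroup (Fin (n + 2)) ℝ) :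
    g ∈ SOQ n ↔ g.1ᵀ * J n * g.1 = J n := by
  refine ⟨fun h ↦ eq_of_dotProduct_mulVec_eq fun x y ↦ ?_, fun h x ↦ ?_⟩
  · have hpolar : (Q n).polarBilin (g.1 *ᵥ x) (g.1 *ᵥ y) = (Q n).polarBilin x y := by
      simp only [QuadraticMap.polarBilin_apply_apply, QuadraticMap.polar, ← mulVec_add, h _]
    rw [polarBilin_Q_apply, polarBilin_Q_apply, dotProduct_mulVec_mulVec] at hpolar
    linarith
  · rw [Q_apply, Q_apply, dotProduct_mulVec_mulVec, h]

lemma SOQ.dotProduct_J {g : SpecialLinearGroup (Fin (n + 2)) ℝ} (hg : g ∈ SOQ n)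
    (x y : Fin (n + 2) → ℝ) : (g.1 *ᵥ x) ⬝ᵥ (J n *ᵥ (g.1 *ᵥ y)) = x ⬝ᵥ (J n *ᵥ y) := by
  rw [dotProduct_mulVec_mulVec, (mem_SOQ_iff g).1 hg]

lemma SOQ.dotProduct_J_mulVec {g : SpecialLinearGroup (Fin (n + 2)) ℝ} (hg : g ∈ SOQ n)
    (x y : Fin (n + 2) → ℝ) : x ⬝ᵥ (J n *ᵥ (g.1 *ᵥ y)) = ((g⁻¹).1 *ᵥ x) ⬝ᵥ (J n *ᵥ y) := by
  rw [← SOQ.dotProduct_J hg ((g⁻¹).1 *ᵥ x) y, SL.mulVec_inv_mulVec]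

/-! ### The negative definite plane -/

variable (n) in
omit hn in
/-- The vector `e₁ - eₙ₊₂`, which spans the `Q`-orthogonal complement of `V`. -/
def eps : Fin (n + 2) → ℝ := Pi.single 0 1 - Pi.single (Fin.last (n + 1)) 1

variable (n) in
omit hn in
/-- The vector `e₂ - eₙ₊₁`, the base point of the hyperboloid `{Q = -2}` in `V`. -/
def basePt : Fin (n + 2) → ℝ := Pi.single 1 1 - Pi.single ⟨n, by omega⟩ 1

omit hn in
lemma eps_dotProduct (x : Fin (n + 2) → ℝ) : eps n ⬝ᵥ x = x 0 - x (Fin.last (n + 1)) := by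
  simp [eps, sub_dotProduct]

omit hn in
lemma basePt_dotProduct (x : Fin (n + 2) → ℝ) : basePt n ⬝ᵥ x = x 1 - x ⟨n, by omega⟩ := by
  simp [basePt, sub_dotProduct]

omit hn in
lemma mem_V_iff (x : Fin (n + 2) → ℝ) : x ∈ V n ↔ eps n ⬝ᵥ x = 0 := by
  rw [eps_dotProduct, sub_eq_zero]
  rfl

@[simp]
lemma J_eps : J n *ᵥ eps n = -eps n := by
  rw [eps, mulVec_sub, J_single, J_single, dual_zero, dual_last, neg_sub]

@[simp]
lemma J_basePt : J n *ᵥ basePt n = -basePt n := by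
  rw [basePt, mulVec_sub, J_single, J_single, dual_one, dual_penultimate, neg_sub]

lemma eps_dotProduct_J (x : Fin (n + 2) → ℝ) : eps n ⬝ᵥ (J n *ᵥ x) = -(eps n ⬝ᵥ x) := by
  rw [dotProduct_J_comm, J_eps, neg_dotProduct]

lemma basePt_dotProduct_J (x : Fin (n + 2) → ℝ) :
    basePt n ⬝ᵥ (J n *ᵥ x) = -(basePt n ⬝ᵥ x) := by
  rw [dotProduct_J_comm, J_basePt, neg_dotProduct]

omit hn in
@[simp]
lemma eps_dotProduct_eps : eps n ⬝ᵥ eps n = 2 := by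
  rw [eps_dotProduct]
  norm_num [eps, Fin.ext_iff]

@[simp]
lemma basePt_dotProduct_basePt : basePt n ⬝ᵥ basePt n = 2 := by
  have hne : n ≠ 1 := by have := hn.prop; omega
  rw [basePt_dotProduct]
  norm_num [basePt, Fin.ext_iff, hne, hne.symm]

@[simp]
lemma eps_dotProduct_basePt : eps n ⬝ᵥ basePt n = 0 := by
  have hne : n ≠ 0 := by have := hn.prop; omega
  rw [eps_dotProduct]
  simp [basePt, Fin.ext_iff, hne, hne.symm]

lemma sub_J_mulVec (x : Fin (n + 2) → ℝ) :
    x - J n *ᵥ x = (eps n ⬝ᵥ x) • eps n + (basePt n ⬝ᵥ x) • basePt n := by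
  have h2 := hn.prop
  have hn0 : n ≠ 0 := by omega
  have hn1 : n ≠ 1 := by omega
  ext i
  simp only [Pi.sub_apply, J_mulVec_apply, Pi.add_apply, Pi.smul_apply, smul_eq_mul, eps,
    basePt, Pi.single_apply]
  rcases index_cases i with rfl | rfl | rfl | rfl | h
  · simp [dual_zero, Fin.ext_iff, hn0.symm]
  · simp [dual_last, Fin.ext_iff, hn0]
  · simp [dual_one, Fin.ext_iff, hn0, hn1.symm]
  · simp [dual_penultimate, Fin.ext_iff, hn0, hn1]
  · rw [dual_of_middle h, sub_self]
    simp only [Fin.ext_iff, Fin.val_zero, Fin.val_last, Fin.val_one]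
    simp only [show i.val ≠ 0 by omega, show i.val ≠ 1 by omega, show i.val ≠ n by omega,
      show i.val ≠ n + 1 by omega, if_false, sub_zero, mul_zero, add_zero]

lemma dotProduct_eq_add (x y : Fin (n + 2) → ℝ) :
    x ⬝ᵥ y = x ⬝ᵥ (J n *ᵥ y) + (eps n ⬝ᵥ x) * (eps n ⬝ᵥ y)
      + (basePt n ⬝ᵥ x) * (basePt n ⬝ᵥ y) := by
  have h := congrArg (x ⬝ᵥ ·) (sub_J_mulVec y)
  simp only [dotProduct_sub, dotProduct_add, dotProduct_smul, smul_eq_mul,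
    dotProduct_comm x (eps n), dotProduct_comm x (basePt n)] at h
  linarith

lemma dotProduct_self_eq_add (x : Fin (n + 2) → ℝ) :
    x ⬝ᵥ x = x ⬝ᵥ (J n *ᵥ x) + (eps n ⬝ᵥ x) ^ 2 + (basePt n ⬝ᵥ x) ^ 2 := by
  rw [dotProduct_eq_add, sq, sq]

/-! ### Identity components -/

section IdentityComponent

variable {S : Type*} [Group S] [TopologicalSpace S] [IsTopologicalGroup S] {L : Subgroup S}

lemma mem_identityComponent_iff {g : S} :
    g ∈ identityComponent L ↔ ∃ h : g ∈ L, (⟨g, h⟩ : L) ∈ connectedComponent (1 : L) := by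
  constructor
  · rintro ⟨⟨x, hx⟩, h, rfl⟩
    exact ⟨hx, h⟩
  · rintro ⟨h, hg⟩
    exact ⟨⟨g, h⟩, hg, rfl⟩

variable (L) in
lemma identityComponent_le : identityComponent L ≤ L := fun _ h ↦
  (mem_identityComponent_iff.1 h).1

lemma mem_identityComponent_of_path {X : Type*} [TopologicalSpace X] [PreconnectedSpace X]
    {φ : X → S} (hφ : Continuous φ) (hL : ∀ x, φ x ∈ L) {x₀ : X} (h1 : φ x₀ = 1) (x : X) :
    φ x ∈ identityComponent L := by
  refine mem_identityComponent_iff.2 ⟨hL x, ?_⟩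
  have hrange := isPreconnected_range (hφ.subtype_mk hL)
  exact hrange.subset_connectedComponent ⟨x₀, Subtype.ext h1⟩ ⟨x, rfl⟩

lemma pos_of_mem_identityComponent {F : S → ℝ} (hF : Continuous F) (h0 : ∀ g ∈ L, F g ≠ 0)
    (h1 : 0 < F 1) {g : S} (hg : g ∈ identityComponent L) : 0 < F g := by
  obtain ⟨hgL, hc⟩ := mem_identityComponent_iff.1 hg
  by_contra! hneg
  obtain ⟨x, -, hx⟩ := isPreconnected_connectedComponent.intermediate_value hc
    (mem_connectedComponent (x := (1 : L))) (hF.comp continuous_subtype_val).continuousOn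
    ⟨hneg, h1.le⟩
  exact h0 x x.2 hx

lemma isClosed_identityComponent (hL : IsClosed (L : Set S)) :
    IsClosed (identityComponent L : Set S) :=
  hL.isClosedEmbedding_subtypeVal.isClosedMap _ isClosed_connectedComponent

end IdentityComponent

lemma continuous_coe_SL {ι : Type*} [Fintype ι] [DecidableEq ι] :
    Continuous fun g : SpecialLinearGroup ι ℝ ↦ g.1 := continuous_subtype_val

lemma mem_identityComponent_of_matrix_path {ι X : Type*} [Fintype ι] [DecidableEq ι]
    [TopologicalSpace X] [PreconnectedSpace X] {L : Subgroup (SpecialLinearGroup ι ℝ)}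
    {φ : X → Matrix ι ι ℝ} (hφ : Continuous φ) (hdet : ∀ x, (φ x).det = 1)
    (hL : ∀ x, (⟨φ x, hdet x⟩ : SpecialLinearGroup ι ℝ) ∈ L) {x₀ : X} (h1 : φ x₀ = 1) {x : X}
    {g : SpecialLinearGroup ι ℝ} (hg : g.1 = φ x) : g ∈ identityComponent L := by
  let ψ : X → SpecialLinearGroup ι ℝ := fun y ↦ ⟨φ y, hdet y⟩
  have hψ : Continuous ψ := hφ.subtype_mk hdet
  rw [show g = ψ x from Subtype.ext hg]
  exact mem_identityComponent_of_path hψ hL (Subtype.ext h1 : ψ x₀ = 1) x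

omit hn in
variable (n) in
lemma G_le_SOQ : G n ≤ SOQ n := identityComponent_le _

omit hn in
variable (n) in
lemma H_le_stabV : H n ≤ stabV n := identityComponent_le _

omit hn in
variable (n) in
lemma H_le_G : H n ≤ G n := fun _ h ↦ (H_le_stabV n h).1

omit hn in
variable (n) in
lemma H_le_SOQ : H n ≤ SOQ n := (H_le_G n).trans (G_le_SOQ n)

omit hn in
lemma mem_stabV_iff {g : SpecialLinearGroup (Fin (n + 2)) ℝ} :
    g ∈ stabV n ↔ g ∈ G n ∧ (∀ x ∈ V n, g.1 *ᵥ x ∈ V n) ∧ ∀ x ∈ V n, (g⁻¹).1 *ᵥ x ∈ V n := by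
  constructor
  · rintro ⟨hg, hV⟩
    refine ⟨hg, fun x hx ↦ ?_, fun x hx ↦ ?_⟩
    · rw [← hV]
      exact ⟨x, hx, rfl⟩
    · rw [← hV] at hx
      obtain ⟨y, hy, rfl⟩ := hx
      rwa [mulVecLin_apply, SL.inv_mulVec_mulVec]
  · rintro ⟨hg, hmaps, hinv⟩
    refine ⟨hg, le_antisymm ?_ fun x hx ↦ ⟨_, hinv x hx, SL.mulVec_inv_mulVec g x⟩⟩
    rintro _ ⟨x, hx, rfl⟩
    exact hmaps x hx

lemma isClosed_SOQ : IsClosed (SOQ n : Set (SpecialLinearGroup (Fin (n + 2)) ℝ)) := by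
  have heq : (SOQ n : Set (SpecialLinearGroup (Fin (n + 2)) ℝ)) = {g | g.1ᵀ * J n * g.1 = J n} :=
    Set.ext mem_SOQ_iff
  have := @continuous_coe_SL (Fin (n + 2)) _ _
  rw [heq]
  exact isClosed_eq (by fun_prop) continuous_const

lemma isClosed_stabV : IsClosed (stabV n : Set (SpecialLinearGroup (Fin (n + 2)) ℝ)) := by
  have heq : (stabV n : Set (SpecialLinearGroup (Fin (n + 2)) ℝ)) = (G n : Set _) ∩
      ((⋂ x ∈ V n, {g | eps n ⬝ᵥ (g.1 *ᵥ x) = 0}) ∩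
        (⋂ x ∈ V n, {g | eps n ⬝ᵥ ((g⁻¹).1 *ᵥ x) = 0})) := by
    ext g
    simp only [Set.mem_inter_iff, Set.mem_iInter, Set.mem_ofPred_eq, SetLike.mem_coe,
      mem_stabV_iff, mem_V_iff]
  have hcoe := @continuous_coe_SL (Fin (n + 2)) _ _
  have hinv : Continuous fun g : SpecialLinearGroup (Fin (n + 2)) ℝ ↦ (g⁻¹).1 :=
    hcoe.comp continuous_inv
  rw [heq]
  exact (isClosed_identityComponent isClosed_SOQ).inter <|
    (isClosed_biInter fun x _ ↦ isClosed_eq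
      (continuous_const.dotProduct (hcoe.matrix_mulVec continuous_const)) continuous_const).inter
    (isClosed_biInter fun x _ ↦ isClosed_eq
      (continuous_const.dotProduct (hinv.matrix_mulVec continuous_const)) continuous_const)

lemma isClosed_H : IsClosed (H n : Set (SpecialLinearGroup (Fin (n + 2)) ℝ)) :=
  isClosed_identityComponent isClosed_stabV

lemma eps_dotProduct_mulVec {g : SpecialLinearGroup (Fin (n + 2)) ℝ} (hg : g ∈ SOQ n)
    (he : g.1 *ᵥ eps n = eps n) (x : Fin (n + 2) → ℝ) : eps n ⬝ᵥ (g.1 *ᵥ x) = eps n ⬝ᵥ x := by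
  have h := SOQ.dotProduct_J_mulVec hg (eps n) x
  rwa [SL.inv_mulVec_of_mulVec_eq he, eps_dotProduct_J, eps_dotProduct_J, neg_inj] at h

lemma mem_stabV_of_mulVec_eps {g : SpecialLinearGroup (Fin (n + 2)) ℝ} (hg : g ∈ G n)
    (he : g.1 *ᵥ eps n = eps n) : g ∈ stabV n := by
  have hgQ := G_le_SOQ n hg
  refine mem_stabV_iff.2 ⟨hg, fun x hx ↦ ?_, fun x hx ↦ ?_⟩ <;> rw [mem_V_iff] at *
  · rw [eps_dotProduct_mulVec hgQ he, hx]
  · rw [eps_dotProduct_mulVec (inv_mem hgQ) (SL.inv_mulVec_of_mulVec_eq he), hx]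

lemma det_sq_eq_one {A : Matrix (Fin (n + 2)) (Fin (n + 2)) ℝ} (hA : Aᵀ * J n * A = J n) :
    A.det ^ 2 = 1 := by
  have hJ : (J n).det ≠ 0 := by
    have h := congrArg det (J_mul_J (n := n))
    rw [det_mul, det_one] at h
    exact left_ne_zero_of_mul_eq_one h
  have h := congrArg det hA
  rw [det_mul, det_mul, det_transpose] at h
  exact mul_left_cancel₀ hJ (by linarith)

section Paths

variable {X : Type*} [TopologicalSpace X] [PreconnectedSpace X]
  {φ : X → Matrix (Fin (n + 2)) (Fin (n + 2)) ℝ}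

lemma det_eq_one_of_path (hφ : Continuous φ) (hJ : ∀ x, (φ x)ᵀ * J n * φ x = J n) {x₀ : X}
    (h1 : φ x₀ = 1) (x : X) : (φ x).det = 1 :=
  isPreconnected_univ.eq_of_sq_eq hφ.matrix_det.continuousOn continuousOn_const
    (fun y _ ↦ (det_sq_eq_one (hJ y)).trans (one_pow 2).symm) (fun _ ↦ one_ne_zero)
    (Set.mem_univ x₀) (by rw [h1, det_one]) (Set.mem_univ x)

lemma mem_G_of_path (hφ : Continuous φ) (hJ : ∀ x, (φ x)ᵀ * J n * φ x = J n) {x₀ : X}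
    (h1 : φ x₀ = 1) {x : X} {g : SpecialLinearGroup (Fin (n + 2)) ℝ} (hg : g.1 = φ x) :
    g ∈ G n :=
  mem_identityComponent_of_matrix_path hφ (det_eq_one_of_path hφ hJ h1)
    (fun y ↦ (mem_SOQ_iff _).2 (hJ y)) h1 hg

lemma mem_H_of_path (hφ : Continuous φ) (hJ : ∀ x, (φ x)ᵀ * J n * φ x = J n) {x₀ : X}
    (h1 : φ x₀ = 1) (he : ∀ x, φ x *ᵥ eps n = eps n) {x : X}
    {g : SpecialLinearGroup (Fin (n + 2)) ℝ} (hg : g.1 = φ x) : g ∈ H n :=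
  mem_identityComponent_of_matrix_path hφ (det_eq_one_of_path hφ hJ h1)
    (fun y ↦ mem_stabV_of_mulVec_eps (mem_G_of_path hφ hJ h1 rfl) (he y)) h1 hg

end Paths

/-! ### The action of `H` on hyperbolic space -/

section DotProduct

variable {ι : Type*} [Fintype ι]

lemma dotProduct_self_nonneg (x : ι → ℝ) : 0 ≤ x ⬝ᵥ x :=
  Finset.sum_nonneg fun i _ ↦ mul_self_nonneg (x i)

lemma dotProduct_sq_le (x y : ι → ℝ) : (x ⬝ᵥ y) ^ 2 ≤ (x ⬝ᵥ x) * (y ⬝ᵥ y) := by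
  simpa only [dotProduct, sq] using Finset.sum_mul_sq_le_sq_mul_sq Finset.univ x y

lemma sq_le_dotProduct_self (x : ι → ℝ) (i : ι) : x i ^ 2 ≤ x ⬝ᵥ x := by
  rw [dotProduct, sq]
  exact Finset.single_le_sum (f := fun i ↦ x i * x i) (fun i _ ↦ mul_self_nonneg _)
    (Finset.mem_univ i)

end DotProduct

omit hn in
lemma eq_smul_eps_of_orthogonal {y : Fin (n + 2) → ℝ} (h : ∀ v ∈ V n, y ⬝ᵥ v = 0) :
    y = (eps n ⬝ᵥ y / 2) • eps n := by
  set z := y - (eps n ⬝ᵥ y / 2) • eps n with hz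
  have hzV : z ∈ V n := by
    rw [mem_V_iff, dotProduct_sub, dotProduct_smul, eps_dotProduct_eps, smul_eq_mul]
    ring
  have hzz : z ⬝ᵥ z = 0 := by
    rw [hz, sub_dotProduct, ← hz, h z hzV, smul_dotProduct, (mem_V_iff _).1 hzV, smul_zero,
      sub_zero]
  exact sub_eq_zero.1 (dotProduct_self_eq_zero.1 hzz)

lemma J_mulVec_mem_V {x : Fin (n + 2) → ℝ} (hx : x ∈ V n) : J n *ᵥ x ∈ V n := by
  rw [mem_V_iff] at *
  rw [eps_dotProduct_J, hx, neg_zero]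

lemma stabV.mulVec_eps {g : SpecialLinearGroup (Fin (n + 2)) ℝ} (hg : g ∈ stabV n) :
    g.1 *ᵥ eps n = (eps n ⬝ᵥ (g.1 *ᵥ eps n) / 2) • eps n := by
  obtain ⟨hG, -, hV⟩ := mem_stabV_iff.1 hg
  refine eq_smul_eps_of_orthogonal fun v hv ↦ ?_
  rw [← J_mulVec_J_mulVec v, ← SL.mulVec_inv_mulVec g (J n *ᵥ v),
    SOQ.dotProduct_J (G_le_SOQ n hG), eps_dotProduct_J,
    (mem_V_iff _).1 (hV _ (J_mulVec_mem_V hv)), neg_zero]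

lemma stabV.eps_dotProduct_mulVec_eps_sq {g : SpecialLinearGroup (Fin (n + 2)) ℝ}
    (hg : g ∈ stabV n) : (eps n ⬝ᵥ (g.1 *ᵥ eps n)) ^ 2 = 4 := by
  have h := SOQ.dotProduct_J (G_le_SOQ n hg.1) (eps n) (eps n)
  rw [stabV.mulVec_eps hg, mulVec_smul, J_eps, smul_neg, dotProduct_neg, dotProduct_neg,
    smul_dotProduct, dotProduct_smul, eps_dotProduct_eps, smul_eq_mul, smul_eq_mul] at h
  linarith

lemma H.mulVec_eps {g : SpecialLinearGroup (Fin (n + 2)) ℝ} (hg : g ∈ H n) :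
    g.1 *ᵥ eps n = eps n := by
  have hpos : 0 < eps n ⬝ᵥ (g.1 *ᵥ eps n) := by
    refine pos_of_mem_identityComponent (F := fun g ↦ eps n ⬝ᵥ (g.1 *ᵥ eps n))
      (continuous_const.dotProduct (continuous_coe_SL.matrix_mulVec continuous_const))
      (fun g hg h0 ↦ ?_) (by simp) hg
    simpa [h0] using stabV.eps_dotProduct_mulVec_eps_sq hg
  have hstab := H_le_stabV n hg
  have htwo : eps n ⬝ᵥ (g.1 *ᵥ eps n) = 2 := by
    nlinarith [stabV.eps_dotProduct_mulVec_eps_sq hstab]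
  rw [stabV.mulVec_eps hstab, htwo, div_self two_ne_zero, one_smul]

/-- The hyperbolic cosine of the distance by which `g` moves the base point of the hyperboloid. -/
def coshDist (n : ℕ) (g : SpecialLinearGroup (Fin (n + 2)) ℝ) : ℝ :=
  (basePt n ⬝ᵥ (g.1 *ᵥ basePt n)) / 2

omit hn in
lemma continuous_coshDist : Continuous (coshDist n) :=
  (continuous_const.dotProduct (continuous_coe_SL.matrix_mulVec continuous_const)).div_const _

omit hn in
lemma basePt_dotProduct_mulVec (g : SpecialLinearGroup (Fin (n + 2)) ℝ) :
    basePt n ⬝ᵥ (g.1 *ᵥ basePt n) = 2 * coshDist n g := by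
  rw [coshDist]
  ring

lemma coshDist_one : coshDist n 1 = 1 := by
  simp [coshDist]

lemma basePt_mem_V : basePt n ∈ V n := (mem_V_iff _).2 eps_dotProduct_basePt

lemma mulVec_basePt_dotProduct_self {g : SpecialLinearGroup (Fin (n + 2)) ℝ}
    (hg : g ∈ stabV n) :
    (g.1 *ᵥ basePt n) ⬝ᵥ (g.1 *ᵥ basePt n) = 4 * coshDist n g ^ 2 - 2 := by
  obtain ⟨hG, hV, -⟩ := mem_stabV_iff.1 hg
  rw [dotProduct_self_eq_add, SOQ.dotProduct_J (G_le_SOQ n hG), basePt_dotProduct_mulVec,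
    (mem_V_iff _).1 (hV _ basePt_mem_V), J_basePt, dotProduct_neg, basePt_dotProduct_basePt]
  ring

lemma one_le_coshDist {g : SpecialLinearGroup (Fin (n + 2)) ℝ} (hg : g ∈ H n) :
    1 ≤ coshDist n g := by
  have hpos : 0 < coshDist n g := by
    refine pos_of_mem_identityComponent continuous_coshDist (fun g hg h0 ↦ ?_)
      (by simp [coshDist_one]) hg
    have hnonneg := dotProduct_self_nonneg (g.1 *ᵥ basePt n)
    norm_num [mulVec_basePt_dotProduct_self hg, h0] at hnonneg
  have hCS := dotProduct_sq_le (basePt n) (g.1 *ᵥ basePt n)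
  rw [mulVec_basePt_dotProduct_self (H_le_stabV n hg), basePt_dotProduct_mulVec,
    basePt_dotProduct_basePt] at hCS
  nlinarith

lemma coshDist_inv_mul {g : SpecialLinearGroup (Fin (n + 2)) ℝ} (hg : g ∈ H n)
    (h : SpecialLinearGroup (Fin (n + 2)) ℝ) :
    2 * coshDist n (g⁻¹ * h) = -((g.1 *ᵥ basePt n) ⬝ᵥ (J n *ᵥ (h.1 *ᵥ basePt n))) := by
  rw [← basePt_dotProduct_mulVec, SL.mul_mulVec, ← neg_eq_iff_eq_neg, ← basePt_dotProduct_J,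
    SOQ.dotProduct_J_mulVec (inv_mem (H_le_SOQ n hg)), inv_inv]

lemma coshDist_inv {g : SpecialLinearGroup (Fin (n + 2)) ℝ} (hg : g ∈ H n) :
    coshDist n g⁻¹ = coshDist n g := by
  have h := coshDist_inv_mul hg 1
  rw [mul_one, show (1 : SpecialLinearGroup (Fin (n + 2)) ℝ).1 = 1 from rfl, one_mulVec,
    J_basePt, dotProduct_neg, neg_neg, dotProduct_comm, basePt_dotProduct_mulVec] at h
  linarith

lemma coshDist_mul_le {g h : SpecialLinearGroup (Fin (n + 2)) ℝ} (hg : g ∈ H n) (hh : h ∈ H n) :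
    coshDist n (g * h) ≤ 2 * (coshDist n g * coshDist n h) := by
  have hinner := coshDist_inv_mul (inv_mem hg) h
  rw [inv_inv] at hinner
  have hCS := dotProduct_sq_le ((g⁻¹).1 *ᵥ basePt n) (J n *ᵥ (h.1 *ᵥ basePt n))
  rw [J_dotProduct_J, mulVec_basePt_dotProduct_self (H_le_stabV n hh),
    mulVec_basePt_dotProduct_self (H_le_stabV n (inv_mem hg)), coshDist_inv hg] at hCS
  have hg1 := one_le_coshDist hg
  have hh1 := one_le_coshDist hh
  have hsq : (2 * coshDist n (g * h)) ^ 2 ≤ (4 * (coshDist n g * coshDist n h)) ^ 2 := by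
    rw [hinner, neg_sq]
    refine hCS.trans ?_
    nlinarith [sq_nonneg (coshDist n g), sq_nonneg (coshDist n h)]
  linarith [(abs_le.1 (abs_le_of_sq_le_sq hsq (by positivity))).2]

lemma mulVec_dotProduct_self_le {g : SpecialLinearGroup (Fin (n + 2)) ℝ} (hg : g ∈ H n)
    (x : Fin (n + 2) → ℝ) :
    (g.1 *ᵥ x) ⬝ᵥ (g.1 *ᵥ x) ≤ (4 * coshDist n g ^ 2) * (x ⬝ᵥ x) := by
  have hgx := dotProduct_self_eq_add (g.1 *ᵥ x)
  rw [SOQ.dotProduct_J (H_le_SOQ n hg),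
    eps_dotProduct_mulVec (H_le_SOQ n hg) (H.mulVec_eps hg)] at hgx
  have hx := dotProduct_self_eq_add x
  have hbase : (basePt n ⬝ᵥ (g.1 *ᵥ x)) ^ 2 ≤ (4 * coshDist n g ^ 2 - 2) * (x ⬝ᵥ x) := by
    rw [← neg_sq, ← basePt_dotProduct_J, SOQ.dotProduct_J_mulVec (H_le_SOQ n hg)]
    refine (dotProduct_sq_le _ _).trans_eq ?_
    rw [J_dotProduct_J, mulVec_basePt_dotProduct_self (H_le_stabV n (inv_mem hg)),
      coshDist_inv hg]
  nlinarith [sq_nonneg (basePt n ⬝ᵥ x), dotProduct_self_nonneg x]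

lemma abs_entry_le_two_mul_coshDist {g : SpecialLinearGroup (Fin (n + 2)) ℝ} (hg : g ∈ H n)
    (i j : Fin (n + 2)) : |g.1 i j| ≤ 2 * coshDist n g := by
  have hcol := (sq_le_dotProduct_self (g.1 *ᵥ Pi.single j 1) i).trans
    (mulVec_dotProduct_self_le hg (Pi.single j 1))
  have hnorm : (Pi.single j 1 : Fin (n + 2) → ℝ) ⬝ᵥ Pi.single j 1 = 1 := by simp
  rw [mulVec_single_one, col_apply, hnorm] at hcol
  exact abs_le_of_sq_le_sq (by linarith) (by linarith [one_le_coshDist hg])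

lemma H.isClosedEmbedding_coe : Topology.IsClosedEmbedding fun h : H n ↦ h.1.1 :=
  SpecialLinearGroup.isClosedEmbedding_val.comp isClosed_H.isClosedEmbedding_subtypeVal

lemma isCompact_coshDist_le (R : ℝ) : IsCompact {h : H n | coshDist n h.1 ≤ R} := by
  have hbox : IsCompact (Set.univ.pi fun _ ↦ Set.univ.pi fun _ ↦ Set.Icc (-(2 * R)) (2 * R) :
      Set (Matrix (Fin (n + 2)) (Fin (n + 2)) ℝ)) :=
    isCompact_univ_pi fun _ ↦ isCompact_univ_pi fun _ ↦ isCompact_Icc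
  refine (H.isClosedEmbedding_coe.isCompact_preimage hbox).of_isClosed_subset
    (isClosed_le (continuous_coshDist.comp continuous_subtype_val) continuous_const) ?_
  intro h (hh : coshDist n h.1 ≤ R) i _ j _
  exact abs_le.1 ((abs_entry_le_two_mul_coshDist h.2 i j).trans (by linarith))

lemma H.locallyCompactSpace : LocallyCompactSpace (H n) := by
  have : LocallyCompactSpace (Matrix (Fin (n + 2)) (Fin (n + 2)) ℝ) :=
    inferInstanceAs (LocallyCompactSpace (Fin (n + 2) → Fin (n + 2) → ℝ))
  exact H.isClosedEmbedding_coe.locallyCompactSpace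

lemma H.secondCountableTopology : SecondCountableTopology (H n) := by
  have : SecondCountableTopology (Matrix (Fin (n + 2)) (Fin (n + 2)) ℝ) :=
    inferInstanceAs (SecondCountableTopology (Fin (n + 2) → Fin (n + 2) → ℝ))
  exact H.isClosedEmbedding_coe.isEmbedding.secondCountableTopology

/-! ### Rotations -/

section Rotations

variable {ι : Type*} [DecidableEq ι]

/-- The Euclidean reflection in the hyperplane orthogonal to `m`, for a vector `m` normalized by
`m ⬝ᵥ m = 2`. -/
def refl (m : ι → ℝ) : Matrix ι ι ℝ := 1 - vecMulVec m m

lemma transpose_refl (m : ι → ℝ) : (refl m)ᵀ = refl m := by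
  rw [refl, transpose_sub, transpose_one, transpose_vecMulVec]

variable [Fintype ι]

lemma refl_mulVec (m x : ι → ℝ) : refl m *ᵥ x = x - (m ⬝ᵥ x) • m := by
  rw [refl, sub_mulVec, one_mulVec, vecMulVec_mulVec, op_smul_eq_smul]

lemma refl_mul_self {m : ι → ℝ} (hm : m ⬝ᵥ m = 2) : refl m * refl m = 1 := by
  refine ext_of_mulVec_single fun i ↦ ?_
  rw [← mulVec_mulVec, one_mulVec, refl_mulVec, refl_mulVec, dotProduct_sub, dotProduct_smul, hm,
    smul_eq_mul]
  module

lemma commute_refl {m : ι → ℝ} {A : Matrix ι ι ℝ} (hA : Aᵀ = A) {c : ℝ} (hm : A *ᵥ m = c • m) :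
    Commute A (refl m) := by
  rw [commute_iff_eq, refl, mul_sub, sub_mul, mul_one, one_mul, mul_vecMulVec, vecMulVec_mul,
    ← mulVec_transpose, hA, hm, smul_vecMulVec, vecMulVec_smul]

lemma refl_mul_mul_refl {m : ι → ℝ} (hm : m ⬝ᵥ m = 2) {A : Matrix ι ι ℝ} (hA : Aᵀ = A) {c : ℝ}
    (hAm : A *ᵥ m = c • m) : (refl m)ᵀ * A * refl m = A := by
  rw [transpose_refl, Matrix.mul_assoc, (commute_refl hA hAm).eq, ← Matrix.mul_assoc,
    refl_mul_self hm, Matrix.one_mul]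

/-- The rotation by the angle `2 s` in the plane of two orthogonal vectors `u` and `v` of square
length `2`, written as a product of two reflections. -/
def rot (u v : ι → ℝ) (s : ℝ) : Matrix ι ι ℝ := refl (Real.cos s • u + Real.sin s • v) * refl u

variable {u v : ι → ℝ}

lemma continuous_rot : Continuous (rot u v) := by
  have h : Continuous fun s : ℝ ↦ Real.cos s • u + Real.sin s • v := by fun_prop
  exact (continuous_const.sub (h.matrix_vecMulVec h)).mul continuous_const

lemma rot_zero (hu : u ⬝ᵥ u = 2) : rot u v 0 = 1 := by
  rw [rot, Real.cos_zero, Real.sin_zero, one_smul, zero_smul, add_zero, refl_mul_self hu]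

lemma transpose_rot_mul_mul (hu : u ⬝ᵥ u = 2) (hv : v ⬝ᵥ v = 2) (huv : u ⬝ᵥ v = 0)
    {A : Matrix ι ι ℝ} (hA : Aᵀ = A) {c : ℝ} (hAu : A *ᵥ u = c • u) (hAv : A *ᵥ v = c • v)
    (s : ℝ) : (rot u v s)ᵀ * A * rot u v s = A := by
  have hm : (Real.cos s • u + Real.sin s • v) ⬝ᵥ (Real.cos s • u + Real.sin s • v) = 2 := by
    simp only [add_dotProduct, dotProduct_add, smul_dotProduct, dotProduct_smul, hu, hv, huv,
      dotProduct_comm v u, smul_eq_mul]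
    linear_combination 2 * Real.sin_sq_add_cos_sq s
  have hAm : A *ᵥ (Real.cos s • u + Real.sin s • v) = c • (Real.cos s • u + Real.sin s • v) := by
    rw [mulVec_add, mulVec_smul, mulVec_smul, hAu, hAv]
    module
  exact transpose_mul_mul_mul_mul (refl_mul_mul_refl hm hA hAm) (refl_mul_mul_refl hu hA hAu)

lemma rot_mulVec_left (hu : u ⬝ᵥ u = 2) (huv : u ⬝ᵥ v = 0) (s : ℝ) :
    rot u v s *ᵥ u = Real.cos (2 * s) • u + Real.sin (2 * s) • v := by
  rw [rot, ← mulVec_mulVec, refl_mulVec, refl_mulVec, hu, dotProduct_sub, dotProduct_smul,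
    add_dotProduct, smul_dotProduct, smul_dotProduct, hu, dotProduct_comm v u, huv,
    Real.cos_two_mul, Real.sin_two_mul]
  simp only [smul_eq_mul]
  module

lemma rot_mulVec_right (hv : v ⬝ᵥ v = 2) (huv : u ⬝ᵥ v = 0) (s : ℝ) :
    rot u v s *ᵥ v = Real.cos (2 * s) • v - Real.sin (2 * s) • u := by
  rw [rot, ← mulVec_mulVec, refl_mulVec, refl_mulVec, huv, zero_smul, sub_zero,
    add_dotProduct, smul_dotProduct, smul_dotProduct, hv, huv, Real.cos_two_mul', Real.cos_sq',
    Real.sin_two_mul]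
  simp only [smul_eq_mul]
  module

lemma rot_mulVec_of_orthogonal {x : ι → ℝ} (hu : u ⬝ᵥ x = 0) (hv : v ⬝ᵥ x = 0) (s : ℝ) :
    rot u v s *ᵥ x = x := by
  rw [rot, ← mulVec_mulVec, refl_mulVec, refl_mulVec, hu, zero_smul, sub_zero,
    add_dotProduct, smul_dotProduct, smul_dotProduct, hu, hv, smul_zero, smul_zero, add_zero,
    zero_smul, sub_zero]

end Rotations

/-! ### The eigenspaces of `J` -/

variable (n) in
/-- The vector `e₁ + eₙ₊₂`, the `J`-fixed counterpart of `eps n`. -/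
def epsPos : Fin (n + 2) → ℝ := Pi.single 0 1 + Pi.single (Fin.last (n + 1)) 1

variable (n) in
/-- The vector `e₂ + eₙ₊₁`, the `J`-fixed counterpart of `basePt n`. -/
def basePos : Fin (n + 2) → ℝ := Pi.single 1 1 + Pi.single ⟨n, by omega⟩ 1

omit hn in
lemma epsPos_dotProduct (x : Fin (n + 2) → ℝ) : epsPos n ⬝ᵥ x = x 0 + x (Fin.last (n + 1)) := by
  simp [epsPos, add_dotProduct]

omit hn in
lemma basePos_dotProduct (x : Fin (n + 2) → ℝ) : basePos n ⬝ᵥ x = x 1 + x ⟨n, by omega⟩ := by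
  simp [basePos, add_dotProduct]

@[simp]
lemma J_epsPos : J n *ᵥ epsPos n = epsPos n := by
  rw [epsPos, mulVec_add, J_single, J_single, dual_zero, dual_last]
  exact add_comm _ _

@[simp]
lemma J_basePos : J n *ᵥ basePos n = basePos n := by
  rw [basePos, mulVec_add, J_single, J_single, dual_one, dual_penultimate]
  exact add_comm _ _

omit hn in
@[simp]
lemma epsPos_dotProduct_epsPos : epsPos n ⬝ᵥ epsPos n = 2 := by
  rw [epsPos_dotProduct]
  norm_num [epsPos, Fin.ext_iff]

@[simp]
lemma basePos_dotProduct_basePos : basePos n ⬝ᵥ basePos n = 2 := by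
  have hne : n ≠ 1 := by have := hn.prop; omega
  rw [basePos_dotProduct]
  norm_num [basePos, Fin.ext_iff, hne, hne.symm]

@[simp]
lemma basePos_dotProduct_epsPos : basePos n ⬝ᵥ epsPos n = 0 := by
  have hne : n ≠ 0 := by have := hn.prop; omega
  rw [basePos_dotProduct]
  simp [epsPos, Fin.ext_iff, hne]

lemma dotProduct_eq_zero_of_J {x y : Fin (n + 2) → ℝ} (hx : J n *ᵥ x = -x)
    (hy : J n *ᵥ y = y) : x ⬝ᵥ y = 0 := by
  have h := dotProduct_J_comm x y
  rw [hx, hy, neg_dotProduct] at h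
  linarith

lemma J_mulVec_eq_self_of_orthogonal {x : Fin (n + 2) → ℝ} (he : eps n ⬝ᵥ x = 0)
    (hb : basePt n ⬝ᵥ x = 0) : J n *ᵥ x = x := by
  have h := sub_J_mulVec x
  rw [he, hb, zero_smul, zero_smul, add_zero, sub_eq_zero] at h
  exact h.symm

lemma rot_mulVec_of_J_neg {u v x : Fin (n + 2) → ℝ} (hu : J n *ᵥ u = u) (hv : J n *ᵥ v = v)
    (hx : J n *ᵥ x = -x) (s : ℝ) : rot u v s *ᵥ x = x :=
  rot_mulVec_of_orthogonal (dotProduct_comm x u ▸ dotProduct_eq_zero_of_J hx hu)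
    (dotProduct_comm x v ▸ dotProduct_eq_zero_of_J hx hv) s

/-! ### The maximal compact subgroup -/

omit hn in
lemma mul_mem_K {g h : SpecialLinearGroup (Fin (n + 2)) ℝ} (hg : g ∈ K n) (hh : h ∈ K n) :
    g * h ∈ K n := by
  refine ⟨mul_mem hg.1 hh.1, ?_⟩
  calc (g.1 * h.1) * (g.1 * h.1)ᵀ = g.1 * (h.1 * h.1ᵀ) * g.1ᵀ := by
        simp only [transpose_mul, Matrix.mul_assoc]
    _ = 1 := by rw [hh.2, Matrix.mul_one, hg.2]

omit hn in
lemma coe_inv_of_mem_K {g : SpecialLinearGroup (Fin (n + 2)) ℝ} (hg : g ∈ K n) :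
    (g⁻¹).1 = g.1ᵀ :=
  left_inv_eq_right_inv (SL.coe_inv_mul g) hg.2

omit hn in
lemma inv_mem_K {g : SpecialLinearGroup (Fin (n + 2)) ℝ} (hg : g ∈ K n) : g⁻¹ ∈ K n := by
  refine ⟨inv_mem hg.1, ?_⟩
  rw [coe_inv_of_mem_K hg, transpose_transpose, mul_eq_one_comm, hg.2]

lemma mem_K_of_mulVec_basePt {l : SpecialLinearGroup (Fin (n + 2)) ℝ} (hl : l ∈ H n)
    (hb : l.1 *ᵥ basePt n = basePt n) : l ∈ K n := by
  refine ⟨H_le_G n hl, ?_⟩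
  rw [mul_eq_one_comm]
  have hbase (x : Fin (n + 2) → ℝ) : basePt n ⬝ᵥ (l.1 *ᵥ x) = basePt n ⬝ᵥ x := by
    have h := SOQ.dotProduct_J_mulVec (H_le_SOQ n hl) (basePt n) x
    rwa [SL.inv_mulVec_of_mulVec_eq hb, basePt_dotProduct_J, basePt_dotProduct_J, neg_inj] at h
  refine eq_of_dotProduct_mulVec_eq fun x y ↦ ?_
  have h := dotProduct_mulVec_mulVec l.1 1 x y
  rw [Matrix.mul_one, one_mulVec] at h
  rw [← h, one_mulVec, dotProduct_eq_add x, dotProduct_eq_add (l.1 *ᵥ x),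
    SOQ.dotProduct_J (H_le_SOQ n hl), hbase, hbase,
    eps_dotProduct_mulVec (H_le_SOQ n hl) (H.mulVec_eps hl),
    eps_dotProduct_mulVec (H_le_SOQ n hl) (H.mulVec_eps hl)]

/-! ### The exponential of the Cartan subspace -/

omit hn in
lemma aVec_of_middle (v : ℝ × ℝ) {i : Fin (n + 2)} (h : 2 ≤ i.val ∧ i.val < n) :
    aVec n v i = 0 := by
  simp [aVec, show i.val ≠ 0 by omega, show i.val ≠ 1 by omega, show i.val ≠ n by omega,
    show i.val ≠ n + 1 by omega]

omit hn in
@[simp]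
lemma aVec_zero_index (v : ℝ × ℝ) : aVec n v 0 = v.1 := by simp [aVec]

omit hn in
@[simp]
lemma aVec_one_index (v : ℝ × ℝ) : aVec n v 1 = v.2 := by simp [aVec]

@[simp]
lemma aVec_penultimate (v : ℝ × ℝ) : aVec n v ⟨n, by omega⟩ = -v.2 := by
  have h := hn.prop
  simp [aVec, show n ≠ 0 by omega, show n ≠ 1 by omega]

omit hn in
@[simp]
lemma aVec_last [NeZero n] (v : ℝ × ℝ) : aVec n v (Fin.last (n + 1)) = -v.1 := by
  simp [aVec, NeZero.ne n]

lemma aVec_dual (v : ℝ × ℝ) (i : Fin (n + 2)) : aVec n v (dual n i) = -aVec n v i := by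
  rcases index_cases i with rfl | rfl | rfl | rfl | h
  · simp [dual_zero]
  · simp [dual_last]
  · simp [dual_one]
  · simp [dual_penultimate]
  · rw [dual_of_middle h, aVec_of_middle v h, neg_zero]

omit hn in
lemma aVec_add (v w : ℝ × ℝ) (i : Fin (n + 2)) : aVec n (v + w) i = aVec n v i + aVec n w i := by
  unfold aVec
  split_ifs <;> simp <;> ring

variable (n) in
/-- The matrix `exp v`, for `v` in the Cartan subspace. -/
def expMat (v : ℝ × ℝ) : Matrix (Fin (n + 2)) (Fin (n + 2)) ℝ :=
  diagonal fun i ↦ Real.exp (aVec n v i)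

omit hn in
lemma transpose_expMat (v : ℝ × ℝ) : (expMat n v)ᵀ = expMat n v := diagonal_transpose _

omit hn in
lemma expMat_mulVec (v : ℝ × ℝ) (x : Fin (n + 2) → ℝ) (i : Fin (n + 2)) :
    (expMat n v *ᵥ x) i = Real.exp (aVec n v i) * x i := by
  rw [expMat, mulVec_diagonal]

omit hn in
lemma expMat_mulVec_single (v : ℝ × ℝ) (i : Fin (n + 2)) :
    expMat n v *ᵥ Pi.single i 1 = Real.exp (aVec n v i) • Pi.single i 1 := by
  rw [expMat, diagonal_mulVec_single, ← Pi.single_smul, smul_eq_mul]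

lemma transpose_expMat_mul_J_mul (v : ℝ × ℝ) : (expMat n v)ᵀ * J n * expMat n v = J n := by
  refine ext_of_mulVec_single fun i ↦ funext fun j ↦ ?_
  rw [← mulVec_mulVec, ← mulVec_mulVec, transpose_expMat, expMat_mulVec, J_mulVec_apply,
    expMat_mulVec, J_mulVec_apply, aVec_dual, ← mul_assoc, ← Real.exp_add, add_neg_cancel,
    Real.exp_zero, one_mul]

omit hn in
lemma expMat_add (v w : ℝ × ℝ) : expMat n (v + w) = expMat n v * expMat n w := by
  simp only [expMat, diagonal_mul_diagonal, ← Real.exp_add, aVec_add]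

omit hn in
lemma expMat_zero : expMat n 0 = 1 := by
  simp [expMat, aVec]

omit hn in
lemma continuous_expMat : Continuous (expMat n) := by
  refine Continuous.matrix_diagonal (continuous_pi fun i ↦ Real.continuous_exp.comp ?_)
  unfold aVec
  split_ifs <;> fun_prop

/-! ### The geodesic flow -/

variable (n) in
/-- The one-parameter group `t ↦ exp (0, t)` of diagonal matrices in `H`; right translation by it
is the geodesic flow on `H`. -/
def flow (t : ℝ) : SpecialLinearGroup (Fin (n + 2)) ℝ :=
  ⟨expMat n (0, t), det_eq_one_of_path continuous_expMat transpose_expMat_mul_J_mul expMat_zero _⟩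

lemma flow_mem_H (t : ℝ) : flow n t ∈ H n := by
  have hc : Continuous fun s : ℝ ↦ expMat n (0, s) := continuous_expMat.comp (by fun_prop)
  refine mem_H_of_path hc (fun s ↦ transpose_expMat_mul_J_mul _) (x₀ := 0) expMat_zero
    (fun s ↦ ?_) (x := t) rfl
  rw [eps, mulVec_sub, expMat_mulVec_single, expMat_mulVec_single]
  simp

lemma flow_mul (s t : ℝ) : flow n s * flow n t = flow n (s + t) := by
  refine Subtype.ext ((expMat_add (0, s) (0, t)).symm.trans ?_)
  rw [Prod.mk_add_mk, add_zero, flow]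

lemma flow_zero : flow n 0 = 1 := Subtype.ext expMat_zero

lemma flow_inv (t : ℝ) : (flow n t)⁻¹ = flow n (-t) := by
  rw [inv_eq_iff_mul_eq_one, flow_mul, add_neg_cancel, flow_zero]

lemma flow_pow (t : ℝ) (k : ℕ) : flow n t ^ k = flow n (k * t) := by
  induction k with
  | zero => simp [flow_zero]
  | succ k ih => rw [pow_succ, ih, flow_mul, Nat.cast_succ, add_one_mul]

lemma flow_mulVec_basePt (t : ℝ) : (flow n t).1 *ᵥ basePt n =
    Real.exp t • Pi.single 1 1 - Real.exp (-t) • Pi.single ⟨n, by omega⟩ 1 := by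
  rw [flow, basePt, mulVec_sub, expMat_mulVec_single, expMat_mulVec_single]
  simp

lemma flow_mulVec_basePt_eq_cosh_add_sinh (t : ℝ) :
    (flow n t).1 *ᵥ basePt n = Real.cosh t • basePt n + Real.sinh t • basePos n := by
  rw [flow_mulVec_basePt, basePt, basePos, Real.cosh_eq, Real.sinh_eq]
  module

lemma coshDist_flow (t : ℝ) : coshDist n (flow n t) = Real.cosh t := by
  rw [coshDist, flow_mulVec_basePt_eq_cosh_add_sinh, dotProduct_add, dotProduct_smul,
    dotProduct_smul, basePt_dotProduct_basePt, dotProduct_eq_zero_of_J J_basePt J_basePos]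
  simp

/-! ### The Cartan decomposition of `H` -/

lemma exists_eq_cos_smul_add_sin_smul {ι : Type*} [Fintype ι] {A : Matrix ι ι ℝ} {b e u : ι → ℝ}
    (hAb : A *ᵥ b = b) (hAe : A *ᵥ e = e) (hAu : A *ᵥ u = u) (hb : b ⬝ᵥ b = 2) (he : e ⬝ᵥ e = 2)
    (hu : u ⬝ᵥ u = 2) (hbe : b ⬝ᵥ e = 0) :
    ∃ v, A *ᵥ v = v ∧ v ⬝ᵥ v = 2 ∧ b ⬝ᵥ v = 0 ∧ ∃ θ, u = Real.cos θ • b + Real.sin θ • v := by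
  obtain ⟨c, hc⟩ : ∃ c, b ⬝ᵥ u = 2 * c := ⟨(b ⬝ᵥ u) / 2, by ring⟩
  set w := u - c • b with hw
  have hAw : A *ᵥ w = w := by rw [hw, mulVec_sub, mulVec_smul, hAu, hAb]
  have hbw : b ⬝ᵥ w = 0 := by
    rw [hw, dotProduct_sub, dotProduct_smul, hc, hb, smul_eq_mul]
    ring
  have hww : w ⬝ᵥ w = 2 * (1 - c ^ 2) := by
    simp only [hw, sub_dotProduct, dotProduct_sub, smul_dotProduct, dotProduct_smul, hu, hb, hc,
      dotProduct_comm u b, smul_eq_mul]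
    ring
  have hc1 : |c| ≤ 1 := by
    rw [← sq_le_one_iff_abs_le_one]
    linarith [dotProduct_self_nonneg w]
  have hcos : Real.cos (Real.arccos c) = c := Real.cos_arccos (abs_le.1 hc1).1 (abs_le.1 hc1).2
  have hsin : w ⬝ᵥ w = 2 * Real.sin (Real.arccos c) ^ 2 := by rw [hww, Real.sin_sq, hcos]
  rcases eq_or_ne (Real.sin (Real.arccos c)) 0 with hs | hs
  · have hw0 : w = 0 := dotProduct_self_eq_zero.1 (by rw [hsin, hs]; ring)
    refine ⟨e, hAe, he, hbe, Real.arccos c, ?_⟩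
    rw [hs, hcos, zero_smul, add_zero]
    exact sub_eq_zero.1 hw0
  · refine ⟨(Real.sin (Real.arccos c))⁻¹ • w, by rw [mulVec_smul, hAw], ?_, ?_, Real.arccos c, ?_⟩
    · rw [smul_dotProduct, dotProduct_smul, hsin, smul_eq_mul, smul_eq_mul]
      field_simp
    · rw [dotProduct_smul, hbw, smul_zero]
    · rw [smul_inv_smul₀ hs, hcos, hw, add_sub_cancel]

lemma exists_mem_H_mulVec_basePos_eq {u : Fin (n + 2) → ℝ} (hJ : J n *ᵥ u = u)
    (hu : u ⬝ᵥ u = 2) :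
    ∃ k ∈ H n, k.1 *ᵥ basePt n = basePt n ∧ k.1 *ᵥ basePos n = u := by
  obtain ⟨v, hJv, hvv, hbv, θ, huv⟩ := exists_eq_cos_smul_add_sin_smul J_basePos J_epsPos hJ
    basePos_dotProduct_basePos epsPos_dotProduct_epsPos hu basePos_dotProduct_epsPos
  have hR := transpose_rot_mul_mul (basePos_dotProduct_basePos (n := n)) hvv hbv transpose_J
    (c := 1) (by simp) (by simp [hJv])
  have h0 : rot (basePos n) v 0 = 1 := rot_zero basePos_dotProduct_basePos
  let k : SpecialLinearGroup (Fin (n + 2)) ℝ :=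
    ⟨rot (basePos n) v (θ / 2), det_eq_one_of_path continuous_rot hR h0 _⟩
  refine ⟨k, mem_H_of_path continuous_rot hR h0 (rot_mulVec_of_J_neg J_basePos hJv J_eps) rfl,
    rot_mulVec_of_J_neg J_basePos hJv J_basePt _, ?_⟩
  have h := rot_mulVec_left (basePos_dotProduct_basePos (n := n)) hbv (θ / 2)
  rwa [mul_div_cancel₀ _ two_ne_zero, ← huv] at h

lemma J_mulVec_mulVec_basePt_sub {h : SpecialLinearGroup (Fin (n + 2)) ℝ} (hh : h ∈ H n) :
    J n *ᵥ (h.1 *ᵥ basePt n - coshDist n h • basePt n)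
      = h.1 *ᵥ basePt n - coshDist n h • basePt n := by
  apply J_mulVec_eq_self_of_orthogonal
  · rw [dotProduct_sub, dotProduct_smul, eps_dotProduct_basePt,
      eps_dotProduct_mulVec (H_le_SOQ n hh) (H.mulVec_eps hh), eps_dotProduct_basePt, smul_zero,
      sub_zero]
  · rw [dotProduct_sub, dotProduct_smul, basePt_dotProduct_basePt, basePt_dotProduct_mulVec,
      smul_eq_mul]
    ring

lemma mulVec_basePt_sub_dotProduct_self {h : SpecialLinearGroup (Fin (n + 2)) ℝ} (hh : h ∈ H n) :
    (h.1 *ᵥ basePt n - coshDist n h • basePt n) ⬝ᵥ (h.1 *ᵥ basePt n - coshDist n h • basePt n)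
      = 2 * (coshDist n h ^ 2 - 1) := by
  simp only [sub_dotProduct, dotProduct_sub, smul_dotProduct, dotProduct_smul, smul_eq_mul,
    mulVec_basePt_dotProduct_self (H_le_stabV n hh), dotProduct_comm _ (basePt n),
    basePt_dotProduct_mulVec, basePt_dotProduct_basePt]
  ring

lemma exists_mulVec_basePt_eq_flow {h : SpecialLinearGroup (Fin (n + 2)) ℝ} (hh : h ∈ H n) :
    ∃ k ∈ H n, k.1 *ᵥ basePt n = basePt n ∧
      h.1 *ᵥ basePt n = (k * flow n (Real.arcosh (coshDist n h))).1 *ᵥ basePt n := by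
  set t := Real.arcosh (coshDist n h)
  set q := h.1 *ᵥ basePt n - coshDist n h • basePt n with hq
  have hJq : J n *ᵥ q = q := J_mulVec_mulVec_basePt_sub hh
  have hcosh : Real.cosh t = coshDist n h := Real.cosh_arcosh (one_le_coshDist hh)
  have hqq : q ⬝ᵥ q = 2 * Real.sinh t ^ 2 := by
    rw [mulVec_basePt_sub_dotProduct_self hh, Real.sinh_sq, hcosh]
  obtain ⟨k, hk, hkb, hkq⟩ : ∃ k ∈ H n, k.1 *ᵥ basePt n = basePt n ∧
      Real.sinh t • (k.1 *ᵥ basePos n) = q := by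
    rcases eq_or_ne (Real.sinh t) 0 with h0 | h0
    · have hq0 : q = 0 := dotProduct_self_eq_zero.1 (by rw [hqq, h0]; ring)
      exact ⟨1, one_mem _, by simp, by rw [h0, hq0, zero_smul]⟩
    · obtain ⟨k, hk, hkb, hku⟩ := exists_mem_H_mulVec_basePos_eq (u := (Real.sinh t)⁻¹ • q)
        (by rw [mulVec_smul, hJq])
        (by rw [smul_dotProduct, dotProduct_smul, hqq, smul_eq_mul, smul_eq_mul]; field_simp)
      exact ⟨k, hk, hkb, by rw [hku, smul_inv_smul₀ h0]⟩
  refine ⟨k, hk, hkb, ?_⟩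
  rw [SL.mul_mulVec, flow_mulVec_basePt_eq_cosh_add_sinh, mulVec_add, mulVec_smul, mulVec_smul,
    hkb, hkq, hcosh, hq, add_sub_cancel]

lemma exists_flow_decomposition {h : SpecialLinearGroup (Fin (n + 2)) ℝ} (hh : h ∈ H n) :
    ∃ k ∈ K n, ∃ l ∈ K n, h = k * flow n (Real.arcosh (coshDist n h)) * l := by
  obtain ⟨k, hk, hkb, hhk⟩ := exists_mulVec_basePt_eq_flow hh
  refine ⟨k, mem_K_of_mulVec_basePt hk hkb, (k * flow n _)⁻¹ * h,
    mem_K_of_mulVec_basePt (mul_mem (inv_mem (mul_mem hk (flow_mem_H _))) hh) ?_,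
    (mul_inv_cancel_left _ h).symm⟩
  rw [SL.mul_mulVec, hhk, SL.inv_mulVec_mulVec]

/-! ### The Weyl element -/

section Rotations

variable {ι : Type*} [DecidableEq ι] [Fintype ι] {u v : ι → ℝ}

lemma rot_pi_div_four_mulVec_left (hu : u ⬝ᵥ u = 2) (huv : u ⬝ᵥ v = 0) :
    rot u v (Real.pi / 4) *ᵥ u = v := by
  rw [rot_mulVec_left hu huv, show 2 * (Real.pi / 4) = Real.pi / 2 by ring, Real.cos_pi_div_two,
    Real.sin_pi_div_two, zero_smul, one_smul, zero_add]

lemma rot_pi_div_four_mulVec_right (hv : v ⬝ᵥ v = 2) (huv : u ⬝ᵥ v = 0) :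
    rot u v (Real.pi / 4) *ᵥ v = -u := by
  rw [rot_mulVec_right hv huv, show 2 * (Real.pi / 4) = Real.pi / 2 by ring, Real.cos_pi_div_two,
    Real.sin_pi_div_two, zero_smul, one_smul, zero_sub]

end Rotations

variable (n) in
/-- The simultaneous rotation by `2 s` in the planes `⟨basePos, epsPos⟩` and `⟨basePt, eps⟩`, a
one-parameter subgroup of `K` which for `s = π / 4` passes through a representative of the Weyl
group element exchanging the two coordinates of `𝔞`. -/
def weylRot (s : ℝ) : Matrix (Fin (n + 2)) (Fin (n + 2)) ℝ :=
  rot (basePos n) (epsPos n) s * rot (basePt n) (eps n) s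

omit hn in
lemma continuous_weylRot : Continuous (weylRot n) := continuous_rot.mul continuous_rot

lemma weylRot_zero : weylRot n 0 = 1 := by
  rw [weylRot, rot_zero basePos_dotProduct_basePos, rot_zero basePt_dotProduct_basePt,
    Matrix.one_mul]

lemma basePt_dotProduct_eps : basePt n ⬝ᵥ eps n = 0 := by
  rw [dotProduct_comm, eps_dotProduct_basePt]

lemma transpose_weylRot_mul_J_mul (s : ℝ) : (weylRot n s)ᵀ * J n * weylRot n s = J n :=
  transpose_mul_mul_mul_mul
    (transpose_rot_mul_mul basePos_dotProduct_basePos epsPos_dotProduct_epsPos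
      basePos_dotProduct_epsPos transpose_J (c := 1) (by simp) (by simp) s)
    (transpose_rot_mul_mul basePt_dotProduct_basePt eps_dotProduct_eps
      basePt_dotProduct_eps transpose_J (c := -1) (by simp) (by simp) s)

lemma transpose_weylRot_mul (s : ℝ) : (weylRot n s)ᵀ * weylRot n s = 1 := by
  have h : (weylRot n s)ᵀ * 1 * weylRot n s = 1 := transpose_mul_mul_mul_mul
    (transpose_rot_mul_mul basePos_dotProduct_basePos epsPos_dotProduct_epsPos
      basePos_dotProduct_epsPos transpose_one (c := 1) (by simp) (by simp) s)
    (transpose_rot_mul_mul basePt_dotProduct_basePt eps_dotProduct_eps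
      basePt_dotProduct_eps transpose_one (c := 1) (by simp) (by simp) s)
  rwa [Matrix.mul_one] at h

lemma weylRot_mulVec_of_J_eq {x : Fin (n + 2) → ℝ} (hx : J n *ᵥ x = x) (s : ℝ) :
    weylRot n s *ᵥ x = rot (basePos n) (epsPos n) s *ᵥ x := by
  rw [weylRot, ← mulVec_mulVec, rot_mulVec_of_orthogonal (dotProduct_eq_zero_of_J J_basePt hx)
    (dotProduct_eq_zero_of_J J_eps hx)]

variable (n) in
/-- A representative in `K` of the Weyl group element exchanging the two coordinates of `𝔞`. -/
def weyl : SpecialLinearGroup (Fin (n + 2)) ℝ :=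
  ⟨weylRot n (Real.pi / 4),
    det_eq_one_of_path continuous_weylRot transpose_weylRot_mul_J_mul weylRot_zero _⟩

lemma weyl_mem_K : weyl n ∈ K n :=
  ⟨mem_G_of_path continuous_weylRot transpose_weylRot_mul_J_mul weylRot_zero rfl,
    mul_eq_one_comm.1 (transpose_weylRot_mul _)⟩

lemma weyl_mulVec_basePos : (weyl n).1 *ᵥ basePos n = epsPos n :=
  (weylRot_mulVec_of_J_eq J_basePos _).trans
    (rot_pi_div_four_mulVec_left basePos_dotProduct_basePos basePos_dotProduct_epsPos)

lemma weyl_mulVec_epsPos : (weyl n).1 *ᵥ epsPos n = -basePos n :=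
  (weylRot_mulVec_of_J_eq J_epsPos _).trans
    (rot_pi_div_four_mulVec_right epsPos_dotProduct_epsPos basePos_dotProduct_epsPos)

lemma weyl_mulVec_basePt : (weyl n).1 *ᵥ basePt n = eps n := by
  change weylRot n (Real.pi / 4) *ᵥ _ = _
  rw [weylRot, ← mulVec_mulVec,
    rot_pi_div_four_mulVec_left basePt_dotProduct_basePt basePt_dotProduct_eps,
    rot_mulVec_of_J_neg J_basePos J_epsPos J_eps]

lemma weyl_mulVec_eps : (weyl n).1 *ᵥ eps n = -basePt n := by
  change weylRot n (Real.pi / 4) *ᵥ _ = _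
  rw [weylRot, ← mulVec_mulVec,
    rot_pi_div_four_mulVec_right eps_dotProduct_eps basePt_dotProduct_eps, mulVec_neg,
    rot_mulVec_of_J_neg J_basePos J_epsPos J_basePt]

lemma exists_weyl_mulVec_single (i : Fin (n + 2)) :
    ∃ (c : ℝ) (j : Fin (n + 2)), (weyl n).1 *ᵥ Pi.single i 1 = c • Pi.single j 1 ∧
      ∀ v : ℝ × ℝ, aVec n v.swap i = aVec n v j := by
  have hfirst : (Pi.single 0 1 : Fin (n + 2) → ℝ) = (2 : ℝ)⁻¹ • (epsPos n + eps n) := by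
    rw [epsPos, eps]; module
  have hlast : (Pi.single (Fin.last (n + 1)) 1 : Fin (n + 2) → ℝ)
      = (2 : ℝ)⁻¹ • (epsPos n - eps n) := by
    rw [epsPos, eps]; module
  have hsecond : (Pi.single 1 1 : Fin (n + 2) → ℝ) = (2 : ℝ)⁻¹ • (basePos n + basePt n) := by
    rw [basePos, basePt]; module
  have hpenultimate : (Pi.single ⟨n, by omega⟩ 1 : Fin (n + 2) → ℝ)
      = (2 : ℝ)⁻¹ • (basePos n - basePt n) := by
    rw [basePos, basePt]; module
  rcases index_cases i with rfl | rfl | rfl | rfl | h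
  · refine ⟨-1, 1, ?_, by simp⟩
    rw [hfirst, hsecond, mulVec_smul, mulVec_add, weyl_mulVec_epsPos, weyl_mulVec_eps]
    module
  · refine ⟨-1, ⟨n, by omega⟩, ?_, by simp⟩
    rw [hlast, hpenultimate, mulVec_smul, mulVec_sub, weyl_mulVec_epsPos, weyl_mulVec_eps]
    module
  · refine ⟨1, 0, ?_, by simp⟩
    rw [hfirst, hsecond, mulVec_smul, mulVec_add, weyl_mulVec_basePos, weyl_mulVec_basePt,
      one_smul]
  · refine ⟨1, Fin.last (n + 1), ?_, by simp⟩
    rw [hlast, hpenultimate, mulVec_smul, mulVec_sub, weyl_mulVec_basePos, weyl_mulVec_basePt,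
      one_smul]
  · refine ⟨1, i, ?_, fun v ↦ by rw [aVec_of_middle _ h, aVec_of_middle _ h]⟩
    have hJ : J n *ᵥ Pi.single i 1 = Pi.single i 1 := by rw [J_single, dual_of_middle h]
    rw [one_smul, weyl, weylRot_mulVec_of_J_eq hJ, rot_mulVec_of_orthogonal]
    · simp [basePos, Fin.ext_iff, show i.val ≠ 1 by omega, show i.val ≠ n by omega]
    · simp [epsPos, Fin.ext_iff, show i.val ≠ 0 by omega, show i.val ≠ n + 1 by omega]

lemma expMat_swap (v : ℝ × ℝ) :
    expMat n v.swap = ((weyl n)⁻¹).1 * expMat n v * (weyl n).1 := by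
  have hcomm : (weyl n).1 * expMat n v.swap = expMat n v * (weyl n).1 :=
    ext_of_mulVec_single fun i ↦ by
      obtain ⟨c, j, hij, hv⟩ := exists_weyl_mulVec_single i
      rw [← mulVec_mulVec, ← mulVec_mulVec, expMat_mulVec_single, mulVec_smul, hij, mulVec_smul,
        expMat_mulVec_single, hv, smul_comm]
  rw [Matrix.mul_assoc, ← hcomm, ← Matrix.mul_assoc, SL.coe_inv_mul, Matrix.one_mul]

/-! ### The Cartan projection on `H` -/

omit hn in
lemma expMat_nsmul (m : ℕ) (v : ℝ × ℝ) : expMat n (m • v) = expMat n v ^ m := by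
  induction m with
  | zero => rw [zero_smul, pow_zero, expMat_zero]
  | succ m ih => rw [succ_nsmul, pow_succ, expMat_add, ih]

lemma trace_expMat (v : ℝ × ℝ) : (expMat n v).trace =
    2 * Real.cosh v.1 + 2 * Real.cosh v.2
      + ∑ i : Fin (n + 2) with 2 ≤ i.val ∧ i.val < n, (1 : ℝ) := by
  have hmiddle : ∑ i : Fin (n + 2) with 2 ≤ i.val ∧ i.val < n, Real.exp (aVec n v i)
      = ∑ i : Fin (n + 2) with 2 ≤ i.val ∧ i.val < n, (1 : ℝ) :=
    Finset.sum_congr rfl fun i hi ↦ by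
      rw [aVec_of_middle v (Finset.mem_filter.1 hi).2, Real.exp_zero]
  rw [expMat, trace_diagonal, sum_eq_sum_ends_add_sum_middle, hmiddle, Real.cosh_eq, Real.cosh_eq]
  simp only [aVec_zero_index, aVec_one_index, aVec_last, aVec_penultimate]
  ring

omit hn in
lemma IsCartanProj.trace_pow_mul_transpose {g : SpecialLinearGroup (Fin (n + 2)) ℝ} {v : ℝ × ℝ}
    (h : IsCartanProj n g v) (m : ℕ) :
    ((g.1 * g.1ᵀ) ^ m).trace = (expMat n (m • (v + v))).trace := by
  obtain ⟨-, k, hk, l, hl, hg⟩ := h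
  let u : (Matrix (Fin (n + 2)) (Fin (n + 2)) ℝ)ˣ := ⟨k.1, k.1ᵀ, hk.2, mul_eq_one_comm.1 hk.2⟩
  have hgg : g.1 * g.1ᵀ = u.1 * expMat n (v + v) * (u⁻¹).1 := by
    calc g.1 * g.1ᵀ = k.1 * expMat n v * (l.1 * l.1ᵀ) * ((expMat n v)ᵀ * k.1ᵀ) := by
          simp only [hg, expMat, transpose_mul, Matrix.mul_assoc]
      _ = k.1 * expMat n (v + v) * k.1ᵀ := by
          rw [hl.2, Matrix.mul_one, transpose_expMat, expMat_add]
          simp only [Matrix.mul_assoc]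
  rw [hgg, Units.conj_pow, trace_units_conj, expMat_nsmul]

lemma eq_zero_and_abs_eq_of_cosh_add_cosh_eq {a b c : ℝ}
    (h1 : Real.cosh a + Real.cosh b = Real.cosh c + 1)
    (h2 : Real.cosh (2 * a) + Real.cosh (2 * b) = Real.cosh (2 * c) + 1) (hba : |b| ≤ |a|) :
    b = 0 ∧ |a| = |c| := by
  simp only [Real.cosh_two_mul, Real.sinh_sq] at h2
  have hprod : (Real.cosh a - 1) * (Real.cosh b - 1) = 0 := by
    linear_combination (Real.cosh a + Real.cosh b - 1 + Real.cosh c) / 2 * h1 - h2 / 4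
  have hle := Real.cosh_le_cosh.2 hba
  have hb1 := Real.one_le_cosh b
  have hcosh : Real.cosh b = 1 := by rcases mul_eq_zero.1 hprod with h | h <;> linarith
  refine ⟨by_contra fun h ↦ (Real.one_lt_cosh.2 h).ne' hcosh, ?_⟩
  refine Real.cosh_injOn (abs_nonneg a) (abs_nonneg c) ?_
  rw [Real.cosh_abs, Real.cosh_abs]
  linarith

lemma IsCartanProj.eq_of_snd_eq_zero {g : SpecialLinearGroup (Fin (n + 2)) ℝ} {v : ℝ × ℝ}
    (hv : IsCartanProj n g v) {t : ℝ} (ht : IsCartanProj n g (t, 0)) : v = (t, 0) := by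
  have htrace (m : ℕ) : (expMat n (m • (v + v))).trace
      = (expMat n (m • ((t, (0 : ℝ)) + (t, 0)))).trace := by
    rw [← hv.trace_pow_mul_transpose, ← ht.trace_pow_mul_transpose]
  have h1 := htrace 1
  have h2 := htrace 2
  rw [trace_expMat, trace_expMat] at h1 h2
  norm_num [← two_mul] at h1 h2
  have hle : |v.2| ≤ v.1 := hv.1.1
  have hv0 : 0 ≤ v.1 := (abs_nonneg _).trans hle
  have ht0 : 0 ≤ t := by simpa using ht.1.1
  obtain ⟨hsnd, hfst⟩ := eq_zero_and_abs_eq_of_cosh_add_cosh_eq (a := 2 * v.1) (b := 2 * v.2)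
    (c := 2 * t) (by linarith) (by linarith)
    (by rw [abs_mul, abs_mul, abs_of_nonneg hv0]; gcongr)
  rw [abs_of_nonneg (by linarith), abs_of_nonneg (by linarith)] at hfst
  exact Prod.ext (by simpa using hfst) (by simpa using hsnd)

lemma isCartanProj_of_mem_H {h : SpecialLinearGroup (Fin (n + 2)) ℝ} (hh : h ∈ H n) :
    IsCartanProj n h (Real.arcosh (coshDist n h), 0) := by
  obtain ⟨k, hk, l, hl, hkl⟩ := exists_flow_decomposition hh
  refine ⟨⟨by simpa using Real.arcosh_nonneg (one_le_coshDist hh), fun _ ↦ le_rfl⟩,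
    k * (weyl n)⁻¹, mul_mem_K hk (inv_mem_K weyl_mem_K), weyl n * l, mul_mem_K weyl_mem_K hl, ?_⟩
  calc h.1 = k.1 * expMat n (Real.arcosh (coshDist n h), 0).swap * l.1 := congrArg Subtype.val hkl
    _ = k.1 * ((weyl n)⁻¹).1 * expMat n (Real.arcosh (coshDist n h), 0) * ((weyl n).1 * l.1) := by
      rw [expMat_swap]
      simp only [Matrix.mul_assoc]

lemma cartanProj_of_mem_H {h : SpecialLinearGroup (Fin (n + 2)) ℝ} (hh : h ∈ H n) :
    cartanProj n h = (Real.arcosh (coshDist n h), 0) :=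
  (Classical.epsilon_spec (p := IsCartanProj n h) ⟨_, isCartanProj_of_mem_H hh⟩).eq_of_snd_eq_zero
    (isCartanProj_of_mem_H hh)

variable (n) in
lemma cartanProj_image_H :
    cartanProj n '' (H n : Set (SpecialLinearGroup (Fin (n + 2)) ℝ)) = {v | 0 ≤ v.1 ∧ v.2 = 0} := by
  ext v
  constructor
  · rintro ⟨h, hh, rfl⟩
    rw [cartanProj_of_mem_H hh]
    exact ⟨Real.arcosh_nonneg (one_le_coshDist hh), rfl⟩
  · rintro ⟨h1, h2⟩
    refine ⟨flow n v.1, flow_mem_H _, ?_⟩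
    rw [cartanProj_of_mem_H (flow_mem_H _), coshDist_flow, Real.arcosh_cosh h1]
    exact Prod.ext rfl h2.symm

/-! ### The horospherical subgroup -/

/-- The indices of the free coordinates of a vector of `V` with `x₂ = xₙ₊₁ = 0`, the last
coordinate of which is determined by the first. -/
abbrev HoroIndex (n : ℕ) : Type := {j : Fin (n + 2) // j.val ≠ 1 ∧ j.val < n}

lemma card_horoIndex : Fintype.card (HoroIndex n) = n - 1 := by
  have h := hn.prop
  have hfilter : (Finset.univ.filter fun j : Fin (n + 2) ↦ j.val ≠ 1 ∧ j.val < n) =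
      ((Finset.range n).erase 1).attachFin fun m hm ↦ by
        have := Finset.mem_range.1 (Finset.mem_of_mem_erase hm); omega := by
    ext j
    simp
  rw [Fintype.card_subtype, hfilter, Finset.card_attachFin,
    Finset.card_erase_of_mem (Finset.mem_range.2 (by omega)), Finset.card_range]

/-- The vector of `V` with `x₂ = xₙ₊₁ = 0` and free coordinates `z`. -/
def horoVec (z : HoroIndex n → ℝ) : Fin (n + 2) → ℝ := fun i ↦
  if h : i.val ≠ 1 ∧ i.val < n then z ⟨i, h⟩
  else if i.val = n + 1 then z ⟨0, zero_ne_one, zero_lt_two.trans_le hn.prop⟩ else 0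

lemma horoVec_apply (z : HoroIndex n → ℝ) (j : HoroIndex n) : horoVec z j.1 = z j :=
  dif_pos j.2

lemma horoVec_one (z : HoroIndex n → ℝ) : horoVec z 1 = 0 := by
  have h := hn.prop
  simp [horoVec, show n ≠ 0 by omega]

lemma horoVec_penultimate (z : HoroIndex n → ℝ) : horoVec z ⟨n, by omega⟩ = 0 := by
  simp [horoVec]

lemma horoVec_last (z : HoroIndex n → ℝ) : horoVec z (Fin.last (n + 1)) = horoVec z 0 := by
  have h := hn.prop
  simp [horoVec, show 0 < n by omega]

lemma horoVec_add (z z' : HoroIndex n → ℝ) : horoVec (z + z') = horoVec z + horoVec z' := by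
  ext i
  simp only [horoVec, Pi.add_apply]
  split_ifs <;> simp

lemma horoVec_zero : horoVec (0 : HoroIndex n → ℝ) = 0 := by
  ext i
  simp [horoVec]

lemma continuous_horoVec : Continuous (horoVec (n := n)) := by
  refine continuous_pi fun i ↦ ?_
  unfold horoVec
  split_ifs <;> fun_prop

lemma J_horoVec (z : HoroIndex n → ℝ) : J n *ᵥ horoVec z = horoVec z := by
  apply J_mulVec_eq_self_of_orthogonal
  · rw [eps_dotProduct, horoVec_last, sub_self]
  · rw [basePt_dotProduct, horoVec_one, horoVec_penultimate, sub_self]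

lemma sq_le_horoVec_dotProduct_self (z : HoroIndex n → ℝ) (j : HoroIndex n) :
    z j ^ 2 ≤ horoVec z ⬝ᵥ horoVec z := by
  simpa only [horoVec_apply] using sq_le_dotProduct_self (horoVec z) j.1

lemma horoVec_dotProduct_self_le {z : HoroIndex n → ℝ} {c : ℝ} (h : ∀ j, |z j| ≤ c) :
    horoVec z ⬝ᵥ horoVec z ≤ (n + 2) * c ^ 2 := by
  have hc : 0 ≤ c :=
    (abs_nonneg _).trans (h ⟨0, zero_ne_one, zero_lt_two.trans_le hn.prop⟩)
  have hle : ∀ i ∈ Finset.univ, horoVec z i * horoVec z i ≤ c ^ 2 := by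
    intro i _
    rw [← sq, sq_le_sq, abs_of_nonneg hc]
    unfold horoVec
    split_ifs
    exacts [h _, h _, abs_zero.trans_le hc]
  simpa [dotProduct] using Finset.sum_le_card_nsmul _ _ _ hle

variable (n) in
/-- The unipotent matrix `x ↦ x + xₙ₊₁ w - (w ⬝ x + (w ⬝ w) xₙ₊₁ / 2) e₂`, which for `w` in `V` with
`w₂ = wₙ₊₁ = 0` preserves `Q` and fixes `e₂`. -/
def unip (w : Fin (n + 2) → ℝ) : Matrix (Fin (n + 2)) (Fin (n + 2)) ℝ :=
  1 + vecMulVec w (Pi.single ⟨n, by omega⟩ 1)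
    - vecMulVec (Pi.single 1 1) (w + ((w ⬝ᵥ w) / 2) • Pi.single ⟨n, by omega⟩ 1)

omit hn in
lemma unip_mulVec (w x : Fin (n + 2) → ℝ) : unip n w *ᵥ x =
    x + x ⟨n, by omega⟩ • w - (w ⬝ᵥ x + (w ⬝ᵥ w) / 2 * x ⟨n, by omega⟩) • Pi.single 1 1 := by
  rw [unip, sub_mulVec, add_mulVec, one_mulVec, vecMulVec_mulVec, vecMulVec_mulVec,
    add_dotProduct, smul_dotProduct, single_dotProduct, op_smul_eq_smul,
    op_smul_eq_smul, one_mul, smul_eq_mul]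

omit hn in
lemma unip_zero : unip n 0 = 1 := by
  simp [unip]

omit hn in
lemma continuous_unip : Continuous (unip n) := by
  unfold unip
  have h : Continuous fun w : Fin (n + 2) → ℝ ↦ w ⬝ᵥ w := continuous_id.dotProduct continuous_id
  refine (continuous_const.add (continuous_id.matrix_vecMulVec continuous_const)).sub
    (continuous_const.matrix_vecMulVec (continuous_id.add ?_))
  exact (h.div_const 2).smul continuous_const

lemma penultimate_ne_one : (⟨n, by omega⟩ : Fin (n + 2)) ≠ 1 := by
  have h := hn.prop
  simp only [ne_eq, Fin.ext_iff, Fin.val_one]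
  omega

lemma transpose_unip_mul_J_mul (z : HoroIndex n → ℝ) :
    (unip n (horoVec z))ᵀ * J n * unip n (horoVec z) = J n := by
  refine eq_of_dotProduct_mulVec_eq fun x y ↦ ?_
  have hJw : horoVec z ⬝ᵥ (J n *ᵥ y) = horoVec z ⬝ᵥ y := by rw [dotProduct_J_comm, J_horoVec]
  rw [← dotProduct_mulVec_mulVec, unip_mulVec, unip_mulVec, mulVec_sub, mulVec_add, mulVec_smul,
    mulVec_smul, J_horoVec, J_single, dual_one]
  simp only [sub_dotProduct, add_dotProduct, dotProduct_sub, dotProduct_add, smul_dotProduct,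
    dotProduct_smul, Pi.add_apply, Pi.sub_apply, Pi.smul_apply, single_dotProduct,
    dotProduct_single, smul_eq_mul, mul_zero, mul_one, one_mul,
    Pi.single_eq_of_ne penultimate_ne_one, hJw, horoVec_penultimate, horoVec_one, J_mulVec_apply,
    dual_one, dotProduct_comm x (horoVec z)]
  ring

lemma unip_mul (z z' : HoroIndex n → ℝ) :
    unip n (horoVec z) * unip n (horoVec z') = unip n (horoVec (z + z')) := by
  refine ext_of_mulVec_single fun i ↦ ?_
  rw [← mulVec_mulVec, unip_mulVec _ (Pi.single i 1), unip_mulVec (horoVec z), horoVec_add,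
    unip_mulVec (horoVec z + horoVec z')]
  simp only [dotProduct_sub, dotProduct_add, add_dotProduct, dotProduct_smul, Pi.add_apply,
    Pi.sub_apply, Pi.smul_apply, smul_eq_mul, horoVec_penultimate, horoVec_one,
    Pi.single_eq_of_ne penultimate_ne_one, dotProduct_single_one,
    mul_zero, sub_zero, add_zero, dotProduct_comm (horoVec z') (horoVec z)]
  module

variable (n) in
/-- The horospherical subgroup of `H` contracted by `g ↦ (flow t)⁻¹ * g * flow t` as `t → ∞`, in its
additive parametrization. -/
def horo (z : HoroIndex n → ℝ) : SpecialLinearGroup (Fin (n + 2)) ℝ :=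
  ⟨unip n (horoVec z), det_eq_one_of_path (continuous_unip.comp continuous_horoVec)
    transpose_unip_mul_J_mul (x₀ := 0) (by simp [horoVec_zero, unip_zero]) z⟩

lemma horo_mem_H (z : HoroIndex n → ℝ) : horo n z ∈ H n := by
  refine mem_H_of_path (continuous_unip.comp continuous_horoVec) transpose_unip_mul_J_mul
    (x₀ := 0) (by simp [horoVec_zero, unip_zero]) (fun z ↦ ?_) (x := z) rfl
  have hpen : eps n ⟨n, by omega⟩ = 0 := by simp [eps, Fin.ext_iff, NeZero.ne n]
  have horth : horoVec z ⬝ᵥ eps n = 0 := by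
    rw [dotProduct_comm]
    exact dotProduct_eq_zero_of_J J_eps (J_horoVec z)
  simp only [Function.comp_apply, unip_mulVec, hpen, horth, zero_smul, mul_zero, add_zero, sub_zero]

lemma horo_mul (z z' : HoroIndex n → ℝ) : horo n z * horo n z' = horo n (z + z') :=
  Subtype.ext (unip_mul z z')

lemma horo_zero : horo n 0 = 1 :=
  Subtype.ext ((congrArg (unip n) horoVec_zero).trans unip_zero)

lemma horo_inv (z : HoroIndex n → ℝ) : (horo n z)⁻¹ = horo n (-z) := by
  rw [inv_eq_iff_mul_eq_one, horo_mul, add_neg_cancel, horo_zero]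

lemma coshDist_flow_conj_horo (z : HoroIndex n → ℝ) (t : ℝ) :
    coshDist n (flow n t * horo n z * (flow n t)⁻¹) =
      1 + (horoVec z ⬝ᵥ horoVec z) / 4 * Real.exp t ^ 2 := by
  have hsymm (y) : basePt n ⬝ᵥ ((flow n t).1 *ᵥ y) = ((flow n t).1 *ᵥ basePt n) ⬝ᵥ y := by
    rw [dotProduct_mulVec, ← mulVec_transpose, flow, transpose_expMat]
  have hunip (y) : (horo n z).1 *ᵥ y = unip n (horoVec z) *ᵥ y := rfl
  have hexp : Real.exp t * Real.exp (-t) = 1 := by rw [← Real.exp_add]; simp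
  rw [coshDist, SL.mul_mulVec, SL.mul_mulVec, hsymm, flow_inv, flow_mulVec_basePt,
    flow_mulVec_basePt, hunip, unip_mulVec]
  simp only [neg_neg, sub_dotProduct, smul_dotProduct, dotProduct_sub, dotProduct_smul,
    single_dotProduct, dotProduct_single, Pi.add_apply, Pi.sub_apply, Pi.smul_apply, smul_eq_mul,
    horoVec_penultimate, horoVec_one, Pi.single_eq_same, Pi.single_eq_of_ne penultimate_ne_one,
    Pi.single_eq_of_ne penultimate_ne_one.symm, mul_zero, sub_zero, add_zero, mul_one, one_mul]
  linear_combination hexp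

lemma coshDist_horo (z : HoroIndex n → ℝ) :
    coshDist n (horo n z) = 1 + (horoVec z ⬝ᵥ horoVec z) / 4 := by
  simpa [flow_zero] using coshDist_flow_conj_horo z 0

lemma coshDist_horo_le {z : HoroIndex n → ℝ} (h : ∀ j, |z j| ≤ 1) :
    coshDist n (horo n z) ≤ 1 + (n + 2) / 4 := by
  rw [coshDist_horo]
  linarith [horoVec_dotProduct_self_le h]

lemma lt_coshDist_flow_conj_horo {z : HoroIndex n → ℝ} {t : ℝ} {j : HoroIndex n}
    (h : 24 ≤ |z j| * Real.exp t) :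
    128 < coshDist n (flow n t * horo n z * (flow n t)⁻¹) := by
  have hj : z j ^ 2 / 4 * Real.exp t ^ 2 ≤
      (horoVec z ⬝ᵥ horoVec z) / 4 * Real.exp t ^ 2 := by
    gcongr
    exact sq_le_horoVec_dotProduct_self z j
  have h24 : 24 ^ 2 ≤ (|z j| * Real.exp t) ^ 2 := by gcongr
  rw [mul_pow, sq_abs] at h24
  rw [coshDist_flow_conj_horo]
  linarith

/-! ### The lower bound for the number of lattice points -/

lemma card_mul_measure_le {L ι : Type*} [Group L] [MeasurableSpace L] [MeasurableMul L]
    [Fintype ι] (m : Measure L) [m.IsMulLeftInvariant] (u : ι → L) {S B : Set L}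
    (hS : MeasurableSet S) (hdisj : ∀ p q, p ≠ q → ∀ x ∈ S, ∀ y ∈ S, u p * x ≠ u q * y)
    (hsub : ∀ p, ∀ x ∈ S, u p * x ∈ B) : Fintype.card ι * m S ≤ m B := by
  let T p := ((u p)⁻¹ * ·) ⁻¹' S
  have hT : Pairwise (Function.onFun Disjoint T) := fun p q hpq ↦
    Set.disjoint_left.2 fun y hp hq ↦ hdisj p q hpq _ hp _ hq (by simp)
  calc Fintype.card ι * m S = ∑ p, m (T p) := by
        simp only [T, measure_preimage_mul, Finset.sum_const, Finset.card_univ, nsmul_eq_mul]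
    _ = m (⋃ p, T p) := by
        rw [measure_iUnion hT fun p ↦ measurable_const_mul _ hS, tsum_fintype]
    _ ≤ m B := measure_mono <| Set.iUnion_subset fun p y hy ↦ by simpa using hsub p _ hy

lemma coshDist_inv_mul_le {g h : SpecialLinearGroup (Fin (n + 2)) ℝ} (hg : g ∈ H n)
    (hh : h ∈ H n) : coshDist n (g⁻¹ * h) ≤ 2 * (coshDist n g * coshDist n h) := by
  simpa only [coshDist_inv hg] using coshDist_mul_le (inv_mem hg) hh

lemma coshDist_mul_inv_le {g h : SpecialLinearGroup (Fin (n + 2)) ℝ} (hg : g ∈ H n)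
    (hh : h ∈ H n) : coshDist n (g * h⁻¹) ≤ 2 * (coshDist n g * coshDist n h) := by
  simpa only [coshDist_inv hh] using coshDist_mul_le hg (inv_mem hh)

/-- The points of the grid of mesh `24 * exp (-t)`. Distinct points `z` have elements `horo n z`
which the flow separates by time `t`. -/
def grid (t : ℝ) {M : ℕ} (p : HoroIndex n → Fin M) (j : HoroIndex n) : ℝ :=
  24 * Real.exp (-t) * (p j).val

omit hn in
lemma abs_grid_le_one (t : ℝ) {M : ℕ} (hM : M ≤ Real.exp t / 24) (p : HoroIndex n → Fin M)
    (j : HoroIndex n) : |grid t p j| ≤ 1 := by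
  have hp : ((p j).val : ℝ) ≤ M := by exact_mod_cast (p j).2.le
  rw [grid, abs_of_nonneg (by positivity)]
  calc 24 * Real.exp (-t) * (p j).val ≤ 24 * Real.exp (-t) * (Real.exp t / 24) := by
        gcongr
        exact hp.trans hM
    _ = Real.exp (-t + t) := by
        rw [Real.exp_add]
        ring
    _ = 1 := by rw [neg_add_cancel, Real.exp_zero]

omit hn in
lemma le_abs_grid_sub_mul_exp (t : ℝ) {M : ℕ} {p q : HoroIndex n → Fin M} {j : HoroIndex n}
    (hj : p j ≠ q j) : 24 ≤ |(grid t p - grid t q) j| * Real.exp t := by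
  have hsep : (1 : ℝ) ≤ |((p j).val : ℝ) - (q j).val| := by
    have hne : ((p j).val : ℤ) - (q j).val ≠ 0 := fun h ↦ hj (Fin.ext (by omega))
    exact_mod_cast Int.one_le_abs hne
  calc (24 : ℝ) ≤ 24 * |((p j).val : ℝ) - (q j).val| := le_mul_of_one_le_right (by norm_num) hsep
    _ = 24 * Real.exp (-t + t) * |((p j).val : ℝ) - (q j).val| := by simp
    _ = |(grid t p - grid t q) j| * Real.exp t := by
        rw [Pi.sub_apply, grid, grid, ← mul_sub, abs_mul,
          abs_of_pos (by positivity : 0 < 24 * Real.exp (-t)), Real.exp_add]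
        ring

lemma flow_conj_mem_H (t : ℝ) {g : SpecialLinearGroup (Fin (n + 2)) ℝ} (hg : g ∈ H n) :
    flow n t * g * (flow n t)⁻¹ ∈ H n :=
  mul_mem (mul_mem (flow_mem_H t) hg) (inv_mem (flow_mem_H t))

lemma lt_mul_coshDist_of_horo_mul_eq {z w : HoroIndex n → ℝ} {j : HoroIndex n} {t : ℝ}
    {g h : SpecialLinearGroup (Fin (n + 2)) ℝ} (hg : g ∈ H n) (hh : h ∈ H n)
    (heq : horo n z * g = horo n w * h) (hzw : 24 ≤ |(z - w) j| * Real.exp t) :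
    64 < coshDist n (flow n t * h * (flow n t)⁻¹) * coshDist n (flow n t * g * (flow n t)⁻¹) := by
  have hdiff : horo n (z - w) = h * g⁻¹ := by
    rw [eq_mul_inv_iff_mul_eq, sub_eq_neg_add, ← horo_mul, ← horo_inv, mul_assoc,
      inv_mul_eq_iff_eq_mul, heq]
  have hconj : flow n t * horo n (z - w) * (flow n t)⁻¹ =
      flow n t * h * (flow n t)⁻¹ * (flow n t * g * (flow n t)⁻¹)⁻¹ := by
    rw [hdiff]
    group
  have hlt := lt_coshDist_flow_conj_horo hzw
  rw [hconj] at hlt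
  linarith [coshDist_mul_inv_le (flow_conj_mem_H t hh) (flow_conj_mem_H t hg)]

variable (n) in
/-- The ball of radius `arcosh 2` about the base point, as a set of elements of `H`. -/
def smallBall : Set (H n) := {h | coshDist n h < 2}

omit hn in
lemma isOpen_smallBall : IsOpen (smallBall n) :=
  isOpen_lt (continuous_coshDist.comp continuous_subtype_val) continuous_const

section Packing

variable [MeasurableSpace (H n)] [BorelSpace (H n)] (m : Measure (H n)) [m.IsMulLeftInvariant]
  {t : ℝ}

/- A set which is small both before and after flowing for time `t` is disjoint from its translates
by the points of the grid, all of which lie in a fixed ball. -/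
lemma ofReal_pow_mul_measure_le (ht : 24 ≤ Real.exp t) {S : Set (H n)} (hS : MeasurableSet S)
    (hsmall : ∀ x ∈ S, ∀ y ∈ S, coshDist n (x⁻¹ * y : H n) ≤ 8)
    (hflow : ∀ x ∈ S, ∀ y ∈ S, coshDist n (flow n t * (x⁻¹ * y : H n) * (flow n t)⁻¹) ≤ 8) :
    ENNReal.ofReal ((Real.exp t / 48) ^ (n - 1)) * m S ≤
      m {h : H n | coshDist n h ≤ 16 * (1 + (n + 2) / 4)} := by
  rcases S.eq_empty_or_nonempty with rfl | ⟨x₀, hx₀⟩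
  · simp
  set M := ⌊Real.exp t / 24⌋₊
  have hM : Real.exp t / 48 ≤ M := by
    have h := Nat.div_two_lt_floor ((one_le_div₀ (by norm_num)).2 ht)
    linarith
  let u (p : HoroIndex n → Fin M) : H n := ⟨horo n (grid t p), horo_mem_H _⟩ * x₀⁻¹
  have hu (p) (x : H n) : (u p * x : H n).1 = horo n (grid t p) * (x₀⁻¹ * x : H n).1 :=
    mul_assoc (horo n (grid t p)) (x₀⁻¹).1 x.1
  calc ENNReal.ofReal ((Real.exp t / 48) ^ (n - 1)) * m S
      ≤ ((M ^ (n - 1) : ℕ) : ℝ≥0∞) * m S := by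
        gcongr
        refine ENNReal.ofReal_le_of_le_toReal ?_
        rw [ENNReal.toReal_natCast, Nat.cast_pow]
        gcongr
    _ = Fintype.card (HoroIndex n → Fin M) * m S := by
        rw [Fintype.card_fun, card_horoIndex, Fintype.card_fin]
    _ ≤ _ := card_mul_measure_le m u hS (fun p q hpq x hx y hy hxy ↦ ?_) fun p x hx ↦ ?_
  · obtain ⟨j, hj⟩ := Function.ne_iff.1 hpq
    have heq : horo n (grid t p) * (x₀⁻¹ * x : H n) = horo n (grid t q) * (x₀⁻¹ * y : H n) := by
      rw [← hu, ← hu, hxy]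
    have hlt := lt_mul_coshDist_of_horo_mul_eq (x₀⁻¹ * x).2 (x₀⁻¹ * y).2 heq
      (le_abs_grid_sub_mul_exp t hj)
    have hx8 := hflow x₀ hx₀ x hx
    have hy8 := hflow x₀ hx₀ y hy
    nlinarith [one_le_coshDist (flow_conj_mem_H t (x₀⁻¹ * x).2)]
  · have hgrid := coshDist_horo_le (abs_grid_le_one t (Nat.floor_le (by positivity)) p)
    have hx8 := hsmall x₀ hx₀ x hx
    calc coshDist n (u p * x : H n)
        ≤ 2 * (coshDist n (horo n (grid t p)) * coshDist n (x₀⁻¹ * x : H n)) := by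
          rw [hu]
          exact coshDist_mul_le (horo_mem_H _) (x₀⁻¹ * x).2
      _ ≤ 2 * ((1 + (n + 2) / 4) * 8) := by
          gcongr
          exact zero_le_one.trans (one_le_coshDist (x₀⁻¹ * x).2)
      _ = 16 * (1 + (n + 2) / 4) := by ring

variable (n) in
/-- The geodesic flow as a one-parameter family of elements of `H`. -/
def flowH (t : ℝ) : H n := ⟨flow n t, flow_mem_H t⟩

lemma measure_return_le (ht : 24 ≤ Real.exp t) (γ : H n) :
    m {x ∈ smallBall n | γ * (x * flowH n (-t)) ∈ smallBall n} ≤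
      m {h : H n | coshDist n h ≤ 16 * (1 + (n + 2) / 4)} /
        ENNReal.ofReal ((Real.exp t / 48) ^ (n - 1)) := by
  have hmap : Measurable fun x : H n ↦ γ * (x * flowH n (-t)) :=
    Continuous.measurable (by fun_prop)
  have hsmall (x y : H n) (hx : coshDist n x < 2) (hy : coshDist n y < 2) :
      coshDist n (x⁻¹ * y : H n) ≤ 8 := by
    refine (coshDist_inv_mul_le x.2 y.2).trans ?_
    nlinarith [one_le_coshDist x.2]
  have hpos : 0 < (Real.exp t / 48) ^ (n - 1) := by positivity
  rw [ENNReal.le_div_iff_mul_le (Or.inl (ENNReal.ofReal_pos.2 hpos).ne')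
    (Or.inl ENNReal.ofReal_ne_top), mul_comm]
  refine ofReal_pow_mul_measure_le m ht
    (isOpen_smallBall.measurableSet.inter (hmap isOpen_smallBall.measurableSet))
    (fun x hx y hy ↦ hsmall x y hx.1 hy.1) fun x hx y hy ↦ ?_
  have hflow : (flowH n (-t))⁻¹ = flowH n t :=
    Subtype.ext ((flow_inv (-t)).trans (by rw [neg_neg]; rfl))
  have hxy := hsmall _ _ hx.2 hy.2
  rw [show (γ * (x * flowH n (-t)))⁻¹ * (γ * (y * flowH n (-t))) =
    (flowH n (-t))⁻¹ * (x⁻¹ * y) * flowH n (-t) by group, hflow,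
    ← inv_inv (flowH n (-t)), hflow] at hxy
  exact hxy

end Packing

lemma flowH_pow (t : ℝ) (k : ℕ) : flowH n t ^ k = flowH n (k * t) :=
  Subtype.ext (flow_pow t k)

lemma coshDist_le_mul_cosh_of_return {γ x : H n} {t : ℝ} (hx : x ∈ smallBall n)
    (hret : γ * (x * flowH n t) ∈ smallBall n) :
    coshDist n γ ≤ 16 * Real.cosh t := by
  have hxt : coshDist n (x * flowH n t : H n) ≤ 4 * Real.cosh t := by
    refine (coshDist_mul_le x.2 (flow_mem_H t)).trans ?_
    rw [coshDist_flow]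
    nlinarith [Real.one_le_cosh t, show coshDist n x < 2 from hx]
  calc coshDist n γ = coshDist n (γ * (x * flowH n t) * (x * flowH n t)⁻¹ : H n) := by
        rw [mul_inv_cancel_right]
    _ ≤ 2 * (coshDist n (γ * (x * flowH n t) : H n) * coshDist n (x * flowH n t : H n)) :=
        coshDist_mul_inv_le (γ * (x * flowH n t)).2 (x * flowH n t).2
    _ ≤ 2 * (2 * (4 * Real.cosh t)) := by
        gcongr
        exacts [zero_le_one.trans (one_le_coshDist (x * flowH n t).2), hret.le]
    _ = 16 * Real.cosh t := by ring

lemma sixteen_mul_cosh_le {t : ℝ} (ht : 0 ≤ t) : 16 * Real.cosh t ≤ Real.cosh (t + 4) := by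
  have hcosh : 16 ≤ Real.cosh 4 := by
    have hexp : (32 : ℝ) ≤ Real.exp 4 := by
      calc (32 : ℝ) ≤ 2.7 ^ 4 := by norm_num
        _ ≤ Real.exp 1 ^ 4 := by
            gcongr
            linarith [Real.exp_one_gt_d9]
        _ = Real.exp 4 := by rw [← Real.exp_nat_mul]; norm_num
    rw [Real.cosh_eq]
    linarith [Real.exp_pos (-4)]
  rw [Real.cosh_add]
  nlinarith [Real.cosh_pos t, mul_nonneg (Real.sinh_nonneg_iff.2 ht)
    (Real.sinh_nonneg_iff.2 (zero_le_four (α := ℝ)))]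

lemma tsum_ne_top_of_eventually_le {f g : ℕ → ℝ≥0∞} (hf : ∀ k, f k ≠ ∞) (hg : ∑' k, g k ≠ ∞)
    (hfg : ∀ᶠ k in atTop, f k ≤ g k) : ∑' k, f k ≠ ∞ := by
  obtain ⟨k₀, hk₀⟩ := eventually_atTop.1 hfg
  rw [← ENNReal.summable.sum_add_tsum_nat_add' (k := k₀)]
  refine ENNReal.add_ne_top.2 ⟨ENNReal.sum_ne_top.2 fun k _ ↦ hf k, ne_top_of_le_ne_top hg ?_⟩
  calc ∑' k, f (k + k₀) ≤ ∑' k, g (k + k₀) :=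
        ENNReal.tsum_le_tsum fun k ↦ hk₀ _ (Nat.le_add_left k₀ k)
    _ ≤ ∑' k, g k := ENNReal.tsum_comp_le_tsum_of_injective (add_left_injective k₀) g

section Return

variable [MeasurableSpace (H n)] [BorelSpace (H n)] (m : Measure (H n)) [m.IsHaarMeasure]
  {Δ : Subgroup (H n)}

lemma measure_exists_return_le [Countable Δ] {t C s : ℝ} (ht : 24 ≤ Real.exp t)
    (hcount : (({γ : Δ | coshDist n (γ : H n) ≤ Real.cosh (t + 4)}.encard : ℕ∞) : ℝ≥0∞) ≤
      ENNReal.ofReal (C * Real.exp (s * t))) :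
    m {x ∈ smallBall n | ∃ γ : Δ, (γ : H n) * (x * flowH n (-t)) ∈ smallBall n} ≤
      ENNReal.ofReal (C * 48 ^ (n - 1) * Real.exp ((s - (n - 1)) * t)) *
        m {h : H n | coshDist n h ≤ 16 * (1 + (n + 2) / 4)} := by
  set B := {h : H n | coshDist n h ≤ 16 * (1 + (n + 2) / 4)}
  set A := {γ : Δ | coshDist n (γ : H n) ≤ Real.cosh (t + 4)}
  let R (γ : Δ) : Set (H n) := {x ∈ smallBall n | (γ : H n) * (x * flowH n (-t)) ∈ smallBall n}
  have ht0 : 0 ≤ t := Real.one_le_exp_iff.1 (by linarith)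
  have hsub : {x ∈ smallBall n | ∃ γ : Δ, (γ : H n) * (x * flowH n (-t)) ∈ smallBall n} ⊆
      ⋃ γ ∈ A, R γ := fun x ⟨hx, γ, hγ⟩ ↦ by
    refine Set.mem_iUnion₂.2 ⟨γ, (coshDist_le_mul_cosh_of_return hx hγ).trans ?_, hx, hγ⟩
    rw [Real.cosh_neg]
    exact sixteen_mul_cosh_le ht0
  have hpow : (Real.exp t / 48) ^ (n - 1) = Real.exp ((n - 1) * t) / 48 ^ (n - 1) := by
    rw [div_pow, ← Real.exp_nat_mul, Nat.cast_sub (one_le_two.trans hn.prop), Nat.cast_one]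
  have hexp : Real.exp ((s - (n - 1)) * t) = Real.exp (s * t) / Real.exp ((n - 1) * t) := by
    rw [← Real.exp_sub, sub_mul]
  calc m {x ∈ smallBall n | ∃ γ : Δ, (γ : H n) * (x * flowH n (-t)) ∈ smallBall n}
      ≤ m (⋃ γ ∈ A, R γ) := measure_mono hsub
    _ ≤ ∑' γ : A, m (R γ) := measure_biUnion_le m (Set.to_countable A) _
    _ ≤ ∑' _ : A, m B / ENNReal.ofReal ((Real.exp t / 48) ^ (n - 1)) :=
        ENNReal.tsum_le_tsum fun γ ↦ measure_return_le m ht _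
    _ = (A.encard : ℝ≥0∞) * (m B / ENNReal.ofReal ((Real.exp t / 48) ^ (n - 1))) :=
        ENNReal.tsum_set_const A _
    _ ≤ ENNReal.ofReal (C * Real.exp (s * t)) *
          (m B / ENNReal.ofReal ((Real.exp t / 48) ^ (n - 1))) := by gcongr
    _ = ENNReal.ofReal (C * 48 ^ (n - 1) * Real.exp ((s - (n - 1)) * t)) * m B := by
        rw [ENNReal.div_eq_inv_mul, ← ENNReal.ofReal_inv_of_pos (by positivity), ← mul_assoc,
          ← ENNReal.ofReal_mul' (by positivity), hpow, hexp, inv_div]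
        congr 2
        ring

lemma frequently_lt_encard_natCast [Countable Δ] {F : Set (H n)} (hF : IsFundamentalDomain Δ F m)
    (hfin : m F < ∞) {s : ℝ} (hs : s < n - 1) (C : ℝ) :
    ∃ᶠ k : ℕ in atTop, ENNReal.ofReal (C * Real.exp (s * k)) <
      (({γ : Δ | coshDist n (γ : H n) ≤ Real.cosh (k + 4)}.encard : ℕ∞) : ℝ≥0∞) := by
  have := H.locallyCompactSpace (n := n)
  have := H.secondCountableTopology (n := n)
  have hne : (smallBall n).Nonempty := ⟨1, by simp [smallBall, coshDist_one]⟩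
  have hsub : smallBall n ⊆ {h : H n | coshDist n h ≤ 2} := fun h (hh : coshDist n h < 2) ↦ hh.le
  have hball : m (smallBall n) < ∞ :=
    (measure_mono hsub).trans_lt (isCompact_coshDist_le 2).measure_lt_top
  by_contra hcount
  simp only [not_frequently, not_lt] at hcount
  let bound (k : ℕ) : ℝ≥0∞ :=
    ENNReal.ofReal (C * 48 ^ (n - 1) * Real.exp ((s - (n - 1)) * k)) *
      m {h : H n | coshDist n h ≤ 16 * (1 + (n + 2) / 4)}
  refine tsum_ne_top_of_eventually_le (g := bound) (fun k ↦ ?_) ?_ ?_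
    (tsum_measure_mul_pow_return_eq_top hF hfin (flowH n (-1)) isOpen_smallBall.measurableSet
      (isOpen_smallBall.measure_pos m hne).ne')
  · exact ((measure_mono (Set.sep_subset _ _)).trans_lt hball).ne
  · rw [ENNReal.tsum_mul_right]
    refine ENNReal.mul_ne_top (Summable.tsum_ofReal_ne_top (Summable.mul_left _ ?_))
      (isCompact_coshDist_le _).measure_lt_top.ne
    simpa only [mul_comm] using Real.summable_exp_nat_mul_iff.2 (sub_neg.2 hs)
  · have hexp : ∀ᶠ k : ℕ in atTop, 24 ≤ Real.exp k :=
      (Real.tendsto_exp_atTop.comp tendsto_natCast_atTop_atTop).eventually_ge_atTop 24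
    filter_upwards [hcount, hexp] with k hk hk24
    simpa only [flowH_pow, mul_neg_one] using measure_exists_return_le m hk24 hk

end Return

lemma frequently_lt_encard_coshDist_le {Δ : Subgroup (H n)} (hΔ : IsLattice Δ) {s : ℝ}
    (hs : s < n - 1) (C : ℝ) :
    ∃ᶠ T : ℝ in atTop, ENNReal.ofReal (C * Real.exp (s * T)) <
      (({γ : Δ | coshDist n (γ : H n) ≤ Real.cosh T}.encard : ℕ∞) : ℝ≥0∞) := by
  obtain ⟨hdisc, hmeas⟩ := hΔ
  let _ : MeasurableSpace (H n) := borel (H n)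
  have : BorelSpace (H n) := ⟨rfl⟩
  obtain ⟨m, hm, F, hF, hfin⟩ := hmeas
  have := H.secondCountableTopology (n := n)
  have : Countable Δ := TopologicalSpace.separableSpace_iff_countable.1 inferInstance
  have hT : Tendsto (fun k : ℕ ↦ (k + 4 : ℝ)) atTop atTop :=
    tendsto_atTop_add_const_right _ _ tendsto_natCast_atTop_atTop
  refine hT.frequently ((frequently_lt_encard_natCast m hF hfin hs (C * Real.exp (s * 4))).mono
    fun k hk ↦ ?_)
  rwa [mul_assoc, ← Real.exp_add, ← mul_add, add_comm (4 : ℝ)] at hk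

/-! ### The upper half space model -/

lemma eq_add_horoVec {p : Fin (n + 2) → ℝ} (hp : p ∈ V n) :
    p = p 1 • Pi.single 1 1 + p ⟨n, by omega⟩ • Pi.single ⟨n, by omega⟩ 1
      + horoVec fun j ↦ p j.1 := by
  have hn2 := hn.prop
  have h0 : p 0 = p (Fin.last (n + 1)) := hp
  ext i
  rcases index_cases i with rfl | rfl | rfl | rfl | h
  · simp [horoVec, Fin.ext_iff, show n ≠ 0 by omega, show 0 < n by omega]
  · simp [horoVec, Fin.ext_iff, show n ≠ 0 by omega, h0]
  · simp [horoVec_one, Fin.ext_iff, show 1 ≠ n by omega]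
  · simp [horoVec_penultimate, Fin.ext_iff, show n ≠ 1 by omega]
  · simp [horoVec, Fin.ext_iff, show i.val ≠ 1 by omega, show i.val ≠ n by omega, h.2]

lemma dotProduct_J_eq_of_mem_V {p q : Fin (n + 2) → ℝ} (hp : p ∈ V n) (hq : q ∈ V n) :
    p ⬝ᵥ (J n *ᵥ q) = p 1 * q ⟨n, by omega⟩ + p ⟨n, by omega⟩ * q 1
      + (horoVec fun j ↦ p j.1) ⬝ᵥ (horoVec fun j ↦ q j.1) := by
  have hcoord (a b a' b' : ℝ) (z z' : HoroIndex n → ℝ) :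
      (a • Pi.single 1 1 + b • Pi.single ⟨n, by omega⟩ 1 + horoVec z) ⬝ᵥ
        (J n *ᵥ (a' • Pi.single 1 1 + b' • Pi.single ⟨n, by omega⟩ 1 + horoVec z')) =
      a * b' + b * a' + horoVec z ⬝ᵥ horoVec z' := by
    rw [mulVec_add, mulVec_add, mulVec_smul, mulVec_smul, J_single, J_single, dual_one,
      dual_penultimate, J_horoVec]
    simp only [add_dotProduct, dotProduct_add, smul_dotProduct, dotProduct_smul,
      single_dotProduct, dotProduct_single, Pi.add_apply, Pi.smul_apply, Pi.single_eq_same,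
      Pi.single_eq_of_ne penultimate_ne_one, Pi.single_eq_of_ne penultimate_ne_one.symm,
      horoVec_one, horoVec_penultimate, smul_eq_mul]
    ring
  conv_lhs => rw [eq_add_horoVec hp, eq_add_horoVec hq]
  exact hcoord _ _ _ _ _ _

lemma horoVec_smul (c : ℝ) (z : HoroIndex n → ℝ) : horoVec (c • z) = c • horoVec z := by
  ext i
  simp only [horoVec, Pi.smul_apply, smul_eq_mul]
  split_ifs <;> simp

lemma horoVec_sub (z z' : HoroIndex n → ℝ) : horoVec (z - z') = horoVec z - horoVec z' := by
  rw [eq_sub_iff_add_eq, ← horoVec_add, sub_add_cancel]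

lemma mulVec_basePt_mem_V {g : SpecialLinearGroup (Fin (n + 2)) ℝ} (hg : g ∈ H n) :
    g.1 *ᵥ basePt n ∈ V n := by
  rw [mem_V_iff, eps_dotProduct_mulVec (H_le_SOQ n hg) (H.mulVec_eps hg), eps_dotProduct_basePt]

/-- The reciprocal of the height, in the upper half space model of hyperbolic space, of the image of
the base point under `g`. -/
def invHeight (n : ℕ) (g : SpecialLinearGroup (Fin (n + 2)) ℝ) : ℝ :=
  -(g.1 *ᵥ basePt n) ⟨n, by omega⟩

/-- The horizontal coordinates, in the upper half space model of hyperbolic space, of the image of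
the base point under `g`. -/
def horizontal (n : ℕ) (g : SpecialLinearGroup (Fin (n + 2)) ℝ) (j : HoroIndex n) : ℝ :=
  (g.1 *ᵥ basePt n) j.1 / invHeight n g

omit hn in
lemma mulVec_basePt_penultimate (g : SpecialLinearGroup (Fin (n + 2)) ℝ) :
    (g.1 *ᵥ basePt n) ⟨n, by omega⟩ = -invHeight n g := by
  rw [invHeight, neg_neg]

omit hn in
lemma mulVec_basePt_one (g : SpecialLinearGroup (Fin (n + 2)) ℝ) :
    (g.1 *ᵥ basePt n) 1 = 2 * coshDist n g - invHeight n g := by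
  have h := basePt_dotProduct_mulVec g
  rw [basePt_dotProduct, mulVec_basePt_penultimate] at h
  linarith

lemma two_mul_coshDist_inv_mul_eq_of_coords {g h : SpecialLinearGroup (Fin (n + 2)) ℝ}
    (hg : g ∈ H n)
    (hh : h ∈ H n) : 2 * coshDist n (g⁻¹ * h) =
      (g.1 *ᵥ basePt n) 1 * invHeight n h + invHeight n g * (h.1 *ᵥ basePt n) 1 -
        (horoVec fun j ↦ (g.1 *ᵥ basePt n) j.1) ⬝ᵥ (horoVec fun j ↦ (h.1 *ᵥ basePt n) j.1) := by
  rw [coshDist_inv_mul hg, dotProduct_J_eq_of_mem_V (mulVec_basePt_mem_V hg)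
    (mulVec_basePt_mem_V hh), mulVec_basePt_penultimate, mulVec_basePt_penultimate]
  ring

lemma invHeight_pos {g : SpecialLinearGroup (Fin (n + 2)) ℝ} (hg : g ∈ H n) :
    0 < invHeight n g := by
  have hprod := two_mul_coshDist_inv_mul_eq_of_coords hg hg
  rw [inv_mul_cancel, coshDist_one, mulVec_basePt_one] at hprod
  nlinarith [one_le_coshDist hg,
    dotProduct_self_nonneg (horoVec fun j : HoroIndex n ↦ (g.1 *ᵥ basePt n) j.1)]

lemma horoVec_mulVec_basePt {g : SpecialLinearGroup (Fin (n + 2)) ℝ} (hg : g ∈ H n) :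
    (horoVec fun j ↦ (g.1 *ᵥ basePt n) j.1) = invHeight n g • horoVec (horizontal n g) := by
  rw [← horoVec_smul]
  congr 1
  ext j
  rw [Pi.smul_apply, smul_eq_mul, horizontal, mul_div_cancel₀ _ (invHeight_pos hg).ne']

lemma mulVec_basePt_one_mul_invHeight {g : SpecialLinearGroup (Fin (n + 2)) ℝ} (hg : g ∈ H n) :
    (g.1 *ᵥ basePt n) 1 * invHeight n g =
      1 + invHeight n g ^ 2 * (horoVec (horizontal n g) ⬝ᵥ horoVec (horizontal n g)) / 2 := by
  have hprod := two_mul_coshDist_inv_mul_eq_of_coords hg hg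
  rw [inv_mul_cancel, coshDist_one, horoVec_mulVec_basePt hg, smul_dotProduct, dotProduct_smul,
    smul_eq_mul, smul_eq_mul] at hprod
  linarith

lemma invHeight_lt {g : SpecialLinearGroup (Fin (n + 2)) ℝ} (hg : g ∈ H n) :
    invHeight n g < 2 * coshDist n g := by
  have hpos : 0 < (g.1 *ᵥ basePt n) 1 * invHeight n g := by
    rw [mulVec_basePt_one_mul_invHeight hg]
    have := dotProduct_self_nonneg (horoVec (horizontal n g))
    positivity
  linarith [(mul_pos_iff_of_pos_right (invHeight_pos hg)).1 hpos, mulVec_basePt_one g]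

lemma two_mul_coshDist_inv_mul {g h : SpecialLinearGroup (Fin (n + 2)) ℝ} (hg : g ∈ H n)
    (hh : h ∈ H n) : 2 * coshDist n (g⁻¹ * h) =
      invHeight n g / invHeight n h + invHeight n h / invHeight n g +
        invHeight n g * invHeight n h * (horoVec (horizontal n g - horizontal n h) ⬝ᵥ
          horoVec (horizontal n g - horizontal n h)) / 2 := by
  have hg0 := (invHeight_pos hg).ne'
  have hh0 := (invHeight_pos hh).ne'
  rw [two_mul_coshDist_inv_mul_eq_of_coords hg hh, horoVec_mulVec_basePt hg,
    horoVec_mulVec_basePt hh,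
    eq_div_of_mul_eq hg0 (mulVec_basePt_one_mul_invHeight hg),
    eq_div_of_mul_eq hh0 (mulVec_basePt_one_mul_invHeight hh), horoVec_sub]
  simp only [smul_dotProduct, dotProduct_smul, sub_dotProduct, dotProduct_sub, smul_eq_mul,
    dotProduct_comm (horoVec (horizontal n h)) (horoVec (horizontal n g))]
  field

/-! ### The upper bound for the number of lattice points -/

lemma finite_coshDist_le (Δ : Subgroup (H n)) [DiscreteTopology Δ] (R : ℝ) :
    {γ : Δ | coshDist n (γ : H n) ≤ R}.Finite := by
  have hclosed : IsClosed (Δ : Set (H n)) := Subgroup.isClosed_of_discrete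
  exact isCompact_iff_finite.1
    (hclosed.isClosedEmbedding_subtypeVal.isCompact_preimage (isCompact_coshDist_le R))

/-- The cell containing the image of the base point under `g`, in a decomposition of the upper half
space into cells of bounded diameter: boxes with `k ≤ -log (height) < k + 1` and horizontal sides
`exp (-k)`. -/
def cell (n : ℕ) (g : SpecialLinearGroup (Fin (n + 2)) ℝ) : ℤ × (HoroIndex n → ℤ) :=
  (⌊Real.log (invHeight n g)⌋,
    fun j ↦ ⌊horizontal n g j * Real.exp ⌊Real.log (invHeight n g)⌋⌋)

omit hn in
lemma exp_floor_log_le {y : ℝ} (hy : 0 < y) : Real.exp ⌊Real.log y⌋ ≤ y :=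
  (Real.le_log_iff_exp_le hy).1 (Int.floor_le _)

omit hn in
lemma le_three_mul_exp_floor_log {y : ℝ} (hy : 0 < y) : y ≤ 3 * Real.exp ⌊Real.log y⌋ :=
  calc y ≤ Real.exp (1 + ⌊Real.log y⌋) := by
        rw [← Real.log_le_iff_le_exp hy]
        linarith [Int.lt_floor_add_one (Real.log y)]
    _ = Real.exp 1 * Real.exp ⌊Real.log y⌋ := Real.exp_add _ _
    _ ≤ 3 * Real.exp ⌊Real.log y⌋ := by
        gcongr
        linarith [Real.exp_one_lt_d9]

lemma coshDist_inv_mul_le_of_cell_eq {g h : SpecialLinearGroup (Fin (n + 2)) ℝ} (hg : g ∈ H n)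
    (hh : h ∈ H n) (hcell : cell n g = cell n h) :
    coshDist n (g⁻¹ * h) ≤ 3 + 9 * (n + 2) / 4 := by
  obtain ⟨hlog, hfloor⟩ := Prod.ext_iff.1 hcell
  have hy := invHeight_pos hg
  have hy' := invHeight_pos hh
  have hyE := exp_floor_log_le hy
  have hyE3 := le_three_mul_exp_floor_log hy
  have hyE' := exp_floor_log_le hy'
  have hyE3' := le_three_mul_exp_floor_log hy'
  simp only [cell] at hlog hfloor
  rw [← hlog] at hyE' hyE3' hfloor
  have hdist := two_mul_coshDist_inv_mul hg hh
  set E := Real.exp ⌊Real.log (invHeight n g)⌋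
  have hE : 0 < E := Real.exp_pos _
  set y := invHeight n g
  set y' := invHeight n h
  set D := horoVec (horizontal n g - horizontal n h) ⬝ᵥ horoVec (horizontal n g - horizontal n h)
  have hD0 : 0 ≤ D := dotProduct_self_nonneg _
  have hD : D ≤ (n + 2) * (1 / E) ^ 2 := horoVec_dotProduct_self_le fun j ↦ by
    have habs := Int.abs_sub_lt_one_of_floor_eq_floor (congrFun hfloor j)
    rw [← sub_mul, abs_mul, abs_of_pos hE] at habs
    exact (le_div_iff₀ hE).2 habs.le
  have hratio : y / y' ≤ 3 := (div_le_iff₀ hy').2 (by linarith)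
  have hratio' : y' / y ≤ 3 := (div_le_iff₀ hy).2 (by linarith)
  have hhoriz : y * y' * D ≤ 9 * (n + 2) := by
    calc y * y' * D ≤ (3 * E) * (3 * E) * ((n + 2) * (1 / E) ^ 2) := by gcongr
      _ = 9 * (n + 2) := by field
  linarith

omit hn in
lemma floor_mem_Icc {x B : ℝ} (h : |x| ≤ B) :
    ⌊x⌋ ∈ Finset.Icc (-(⌈B⌉₊ : ℤ)) (⌈B⌉₊ : ℤ) := by
  obtain ⟨hneg, hpos⟩ := abs_le.1 h
  have hB := Nat.le_ceil B
  refine Finset.mem_Icc.2 ⟨Int.le_floor.2 ?_, Int.floor_le_iff.2 ?_⟩ <;> push_cast <;> linarith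

lemma abs_log_invHeight_le {g : SpecialLinearGroup (Fin (n + 2)) ℝ} (hg : g ∈ H n) {R : ℝ}
    (hR : coshDist n g ≤ R) : |Real.log (invHeight n g)| ≤ Real.log (2 * R) := by
  have hy := invHeight_pos hg
  have hprod := mulVec_basePt_one_mul_invHeight hg
  have hR0 : 0 < R := by linarith [one_le_coshDist hg]
  refine abs_le.2 ⟨?_, Real.log_le_log hy (by linarith [invHeight_lt hg])⟩
  rw [← Real.log_inv]
  refine Real.log_le_log (by positivity) ((inv_le_iff_one_le_mul₀ (by positivity)).2 ?_)
  have hone : 1 ≤ (g.1 *ᵥ basePt n) 1 * invHeight n g := by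
    have := dotProduct_self_nonneg (horoVec (horizontal n g))
    rw [hprod]
    exact le_add_of_nonneg_right (by positivity)
  nlinarith [mulVec_basePt_one g]

lemma abs_horizontal_mul_invHeight_le {g : SpecialLinearGroup (Fin (n + 2)) ℝ} (hg : g ∈ H n)
    (j : HoroIndex n) : |horizontal n g j| * invHeight n g ≤ 3 * coshDist n g := by
  have hy := invHeight_pos hg
  have hf := one_le_coshDist hg
  have hprod := mulVec_basePt_one_mul_invHeight hg
  have hle := mul_le_mul_of_nonneg_left (sq_le_horoVec_dotProduct_self (horizontal n g) j)
    (sq_nonneg (invHeight n g))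
  have hone : (g.1 *ᵥ basePt n) 1 ≤ 2 * coshDist n g := by linarith [mulVec_basePt_one g]
  refine abs_le_of_sq_le_sq' ?_ (by linarith) |>.2
  rw [mul_pow, sq_abs]
  nlinarith [invHeight_lt hg]

lemma cell_mem {g : SpecialLinearGroup (Fin (n + 2)) ℝ} (hg : g ∈ H n) {R : ℝ}
    (hR : coshDist n g ≤ R) :
    cell n g ∈ Finset.Icc (-(⌈Real.log (2 * R)⌉₊ : ℤ)) (⌈Real.log (2 * R)⌉₊ : ℤ) ×ˢ
      Fintype.piFinset fun _ : HoroIndex n ↦ Finset.Icc (-(⌈3 * R⌉₊ : ℤ)) (⌈3 * R⌉₊ : ℤ) := by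
  refine Finset.mem_product.2 ⟨floor_mem_Icc (abs_log_invHeight_le hg hR),
    Fintype.mem_piFinset.2 fun j ↦ floor_mem_Icc ?_⟩
  calc |horizontal n g j * Real.exp ⌊Real.log (invHeight n g)⌋|
      = |horizontal n g j| * Real.exp ⌊Real.log (invHeight n g)⌋ := by
        rw [abs_mul, Real.abs_exp]
    _ ≤ |horizontal n g j| * invHeight n g := by
        gcongr
        exact exp_floor_log_le (invHeight_pos hg)
    _ ≤ 3 * coshDist n g := abs_horizontal_mul_invHeight_le hg j
    _ ≤ 3 * R := by gcongr

lemma ncard_coshDist_le_mul (Δ : Subgroup (H n)) [DiscreteTopology Δ] (R : ℝ) :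
    {γ : Δ | coshDist n (γ : H n) ≤ R}.ncard ≤
      {γ : Δ | coshDist n (γ : H n) ≤ 3 + 9 * (n + 2) / 4}.ncard *
        ((2 * ⌈Real.log (2 * R)⌉₊ + 1) * (2 * ⌈3 * R⌉₊ + 1) ^ (n - 1)) := by
  classical
  have hfin := finite_coshDist_le Δ R
  have hfin₀ := finite_coshDist_le Δ (3 + 9 * (n + 2) / 4)
  have hcard (a b : ℕ) : (Finset.Icc (-(a : ℤ)) (a : ℤ) ×ˢ Fintype.piFinset fun _ : HoroIndex n ↦
      Finset.Icc (-(b : ℤ)) (b : ℤ)).card = (2 * a + 1) * (2 * b + 1) ^ (n - 1) := by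
    rw [Finset.card_product, Fintype.card_piFinset, Finset.prod_const, Finset.card_univ,
      card_horoIndex, Int.card_Icc, Int.card_Icc]
    congr 2 <;> omega
  rw [Set.ncard_eq_toFinset_card _ hfin, Set.ncard_eq_toFinset_card _ hfin₀, ← hcard]
  refine Finset.card_le_mul_card_image_of_maps_to (f := fun γ : Δ ↦ cell n (γ : H n))
    (fun γ hγ ↦ cell_mem (γ : H n).2 (hfin.mem_toFinset.1 hγ)) _ fun c _ ↦ ?_
  rcases (hfin.toFinset.filter fun γ : Δ ↦ cell n (γ : H n) = c).eq_empty_or_nonempty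
    with hempty | ⟨γ₀, hγ₀⟩
  · rw [hempty]
    exact Nat.zero_le _
  · refine Finset.card_le_card_of_injOn (γ₀⁻¹ * ·) (fun γ hγ ↦ hfin₀.mem_toFinset.2 ?_)
      (mul_right_injective γ₀⁻¹).injOn
    have hcell := (Finset.mem_filter.1 hγ₀).2.trans (Finset.mem_filter.1 hγ).2.symm
    exact coshDist_inv_mul_le_of_cell_eq (γ₀ : H n).2 (γ : H n).2 hcell

omit hn in
lemma cosh_le_exp {T : ℝ} (hT : 0 ≤ T) : Real.cosh T ≤ Real.exp T := by
  linarith [Real.cosh_add_sinh T, Real.sinh_nonneg_iff.2 hT]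

omit hn in
lemma natCeil_log_two_mul_cosh_le {T : ℝ} (hT : 0 ≤ T) :
    (⌈Real.log (2 * Real.cosh T)⌉₊ : ℝ) ≤ T + 2 := by
  have hcosh := Real.one_le_cosh T
  have hlog : Real.log (2 * Real.cosh T) ≤ T + 1 := by
    rw [Real.log_le_iff_le_exp (by positivity), Real.exp_add, mul_comm]
    have hone := Real.exp_one_gt_d9
    gcongr
    exacts [cosh_le_exp hT, by linarith]
  linarith [Nat.ceil_lt_add_one (Real.log_nonneg (by linarith : 1 ≤ 2 * Real.cosh T))]

lemma exists_encard_coshDist_le (Δ : Subgroup (H n)) [DiscreteTopology Δ] :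
    ∃ A : ℝ, 0 < A ∧ ∀ T : ℝ, 0 ≤ T →
      (({γ : Δ | coshDist n (γ : H n) ≤ Real.cosh T}.encard : ℕ∞) : ℝ≥0∞) ≤
        ENNReal.ofReal (A * (2 * T + 5) * Real.exp ((n - 1) * T)) := by
  set N := {γ : Δ | coshDist n (γ : H n) ≤ 3 + 9 * (n + 2) / 4}.ncard
  refine ⟨(N + 1) * 9 ^ (n - 1), by positivity, fun T hT ↦ ?_⟩
  have hcosh := Real.one_le_cosh T
  have hexp := cosh_le_exp hT
  have hlog := natCeil_log_two_mul_cosh_le hT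
  have hceil := Nat.ceil_lt_add_one (by positivity : 0 ≤ 3 * Real.cosh T)
  rw [← (finite_coshDist_le Δ _).cast_ncard_eq, ENat.toENNReal_coe, ← ENNReal.ofReal_natCast]
  refine ENNReal.ofReal_le_ofReal ?_
  calc ({γ : Δ | coshDist n (γ : H n) ≤ Real.cosh T}.ncard : ℝ)
      ≤ (N * ((2 * ⌈Real.log (2 * Real.cosh T)⌉₊ + 1) *
          (2 * ⌈3 * Real.cosh T⌉₊ + 1) ^ (n - 1)) : ℕ) := Nat.cast_le.2 (ncard_coshDist_le_mul Δ _)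
    _ = N * ((2 * ⌈Real.log (2 * Real.cosh T)⌉₊ + 1) *
          (2 * ⌈3 * Real.cosh T⌉₊ + 1 : ℝ) ^ (n - 1)) := by push_cast; rfl
    _ ≤ (N + 1) * ((2 * T + 5) * (9 * Real.exp T) ^ (n - 1)) := by
        have hlog' : 2 * (⌈Real.log (2 * Real.cosh T)⌉₊ : ℝ) + 1 ≤ 2 * T + 5 := by linarith
        gcongr <;> linarith
    _ = (N + 1) * 9 ^ (n - 1) * (2 * T + 5) * Real.exp ((n - 1) * T) := by
        rw [mul_pow, ← Real.exp_nat_mul, Nat.cast_sub (one_le_two.trans hn.prop), Nat.cast_one]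
        ring

/-! ### The half-sum of the positive roots on `μ(H)` -/

omit hn in
lemma forall_dotProduct_mulVec_eq_zero_iff {ι : Type*} [Fintype ι] {M : Matrix ι ι ℝ} :
    (∀ x, x ⬝ᵥ (M *ᵥ x) = 0) ↔ ∀ i j, M i j = -M j i := by
  classical
  refine ⟨fun h i j ↦ ?_, fun h x ↦ ?_⟩
  · have hsum := h (Pi.single i 1 + Pi.single j 1)
    have hi := h (Pi.single i 1)
    have hj := h (Pi.single j 1)
    simp only [mulVec_add, add_dotProduct, dotProduct_add, mulVec_single_one, single_dotProduct,
      one_mul, col_apply] at hsum hi hj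
    linarith
  · have hM : Mᵀ = -M := Matrix.ext fun i j ↦ h j i
    have hneg : x ⬝ᵥ (M *ᵥ x) = -(x ⬝ᵥ (M *ᵥ x)) := by
      conv_lhs => rw [dotProduct_mulVec, ← mulVec_transpose, hM, neg_mulVec, neg_dotProduct,
        dotProduct_comm]
    linarith

lemma mem_rootSpace_iff {α : (ℝ × ℝ) →ₗ[ℝ] ℝ} {X : Matrix (Fin (n + 2)) (Fin (n + 2)) ℝ} :
    X ∈ rootSpace n α ↔ (∀ i j, X i j = -X (dual n j) (dual n i)) ∧
      ∀ (v : ℝ × ℝ) i j, (aVec n v i - aVec n v j - α v) * X i j = 0 := by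
  have hskew : (∀ x, (Q n).polarBilin x (X *ᵥ x) = 0) ↔
      ∀ i j, X i j = -X (dual n j) (dual n i) := by
    have hJX (i j) : (J n * X) i j = X (dual n i) j := by simp [J, Matrix.mul_apply]
    simp only [polarBilin_Q_apply, mulVec_mulVec, mul_eq_zero, two_ne_zero, false_or,
      forall_dotProduct_mulVec_eq_zero_iff, hJX]
    exact ⟨fun h i j ↦ by simpa only [dual_dual] using h (dual n i) j,
      fun h i j ↦ by simpa only [dual_dual] using h (dual n i) j⟩
  refine and_congr hskew (forall_congr' fun v ↦ ?_)
  rw [← Matrix.ext_iff]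
  refine forall₂_congr fun i j ↦ ?_
  rw [Matrix.sub_apply, diagonal_mul, mul_diagonal, Matrix.smul_apply, smul_eq_mul, ← sub_eq_zero]
  ring_nf

omit hn in
lemma aVec_smul (c : ℝ) (v : ℝ × ℝ) (i : Fin (n + 2)) : aVec n (c • v) i = c * aVec n v i := by
  unfold aVec
  split_ifs <;> simp

omit hn in
lemma eq_zero_or_eq_last_or_exists_eq (i : Fin (n + 2)) :
    i = 0 ∨ i = Fin.last (n + 1) ∨ ∃ j : Fin n, i = j.succ.castSucc := by
  cases i using Fin.lastCases with
  | last => exact .inr (.inl rfl)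
  | cast i =>
    cases i using Fin.cases with
    | zero => exact .inl rfl
    | succ j => exact .inr (.inr ⟨j, rfl⟩)

lemma exists_dual_eq (j : Fin n) : ∃ k : Fin n, dual n j.succ.castSucc = k.succ.castSucc := by
  rcases eq_zero_or_eq_last_or_exists_eq (dual n j.succ.castSucc) with h | h | h
  · rw [dual_eq_iff, dual_zero] at h
    exact absurd h (Fin.castSucc_ne_last _)
  · rw [dual_eq_iff, dual_last] at h
    exact absurd h (Fin.castSucc_ne_zero_iff.2 (Fin.succ_ne_zero j))
  · exact h

omit hn in
lemma aVec_fst (t : ℝ) (j : Fin n) : aVec n (t, 0) j.succ.castSucc = 0 := by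
  have hj := j.isLt
  simp only [aVec, Fin.val_castSucc, Fin.val_succ]
  split_ifs <;> first | contradiction | omega | simp

omit hn in
lemma abs_aVec_le (v : ℝ × ℝ) (j : Fin n) : |aVec n v j.succ.castSucc| ≤ |v.2| := by
  have hj := j.isLt
  simp only [aVec, Fin.val_castSucc, Fin.val_succ]
  split_ifs <;> first | contradiction | omega | simp

/-- The root `v ↦ v₁ - aⱼ`, where `aⱼ` is one of the `n` diagonal entries of `v` other than the
first and the last. -/
def rootForm (n : ℕ) (j : Fin n) : (ℝ × ℝ) →ₗ[ℝ] ℝ where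
  toFun v := v.1 - aVec n v j.succ.castSucc
  map_add' v w := by
    rw [aVec_add, Prod.fst_add]
    ring
  map_smul' c v := by
    rw [aVec_smul, Prod.smul_fst, smul_eq_mul, RingHom.id_apply, smul_eq_mul, mul_sub]

omit hn in
lemma rootForm_apply (j : Fin n) (v : ℝ × ℝ) :
    rootForm n j v = v.1 - aVec n v j.succ.castSucc := rfl

omit hn in
lemma rootForm_fst (j : Fin n) (t : ℝ) : rootForm n j (t, 0) = t := by
  rw [rootForm_apply, aVec_fst, sub_zero]

omit hn in
lemma rootForm_nonneg (j : Fin n) {v : ℝ × ℝ} (hv : v ∈ aplus n) : 0 ≤ rootForm n j v :=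
  sub_nonneg.2 ((le_abs_self _).trans ((abs_aVec_le v j).trans hv.1))

omit hn in
lemma rootForm_ne_zero (j : Fin n) : rootForm n j ≠ 0 := fun h ↦ by
  simpa [rootForm_fst] using LinearMap.congr_fun h (1, 0)

/-- A generator of a root space: the matrix with entry `1` in the first row and column `j`, made
skew with respect to `Q`. -/
def rootVector (j : Fin n) : Matrix (Fin (n + 2)) (Fin (n + 2)) ℝ :=
  Matrix.single 0 j.succ.castSucc 1 -
    Matrix.single (dual n j.succ.castSucc) (Fin.last (n + 1)) 1

lemma rootVector_mem_rootSpace (j : Fin n) : rootVector j ∈ rootSpace n (rootForm n j) := by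
  have hzero (i) : 0 = dual n i ↔ Fin.last (n + 1) = i := by rw [← dual_eq_iff, dual_zero]
  have hlast (i) : Fin.last (n + 1) = dual n i ↔ 0 = i := by rw [← dual_eq_iff, dual_last]
  refine mem_rootSpace_iff.2 ⟨fun a b ↦ ?_, fun v a b ↦ ?_⟩ <;>
    simp only [rootVector, Matrix.sub_apply, Matrix.single_apply, rootForm_apply]
  · simp only [hzero, hlast, ← dual_eq_iff, (dual n).injective.eq_iff, neg_sub,
      and_comm (b := 0 = a), and_comm (b := dual n _ = a)]
  · split_ifs with hfirst hsecond hsecond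
    · exact absurd (hfirst.2.trans hsecond.2.symm) (Fin.castSucc_ne_last _)
    · rw [← hfirst.1, ← hfirst.2, aVec_zero_index]
      ring
    · rw [← hsecond.1, ← hsecond.2, aVec_dual, aVec_last]
      ring
    · rw [sub_zero, mul_zero]

omit hn in
lemma rootVector_zero_apply (j k : Fin n) :
    rootVector j 0 k.succ.castSucc = (Pi.single j 1 : Fin n → ℝ) k := by
  rw [rootVector, Matrix.sub_apply, Matrix.single_apply, Matrix.single_apply,
    if_neg (c := _ ∧ Fin.last (n + 1) = _) fun h ↦ Fin.castSucc_ne_last _ h.2.symm, sub_zero,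
    Pi.single_apply]
  simp only [true_and, Fin.castSucc_inj, Fin.succ_inj, eq_comm (a := j)]

lemma eq_zero_of_mem_rootSpace {α : (ℝ × ℝ) →ₗ[ℝ] ℝ} (hα : 0 < α (1, 0))
    {X : Matrix (Fin (n + 2)) (Fin (n + 2)) ℝ} (hX : X ∈ rootSpace n α)
    (hrow : ∀ j : Fin n, X 0 j.succ.castSucc = 0) : X = 0 := by
  obtain ⟨hskew, hweight⟩ := mem_rootSpace_iff.1 hX
  ext i j
  by_contra hne
  have hval : aVec n (1, 0) i - aVec n (1, 0) j = α (1, 0) :=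
    sub_eq_zero.1 ((mul_eq_zero.1 (hweight (1, 0) i j)).resolve_right hne)
  rcases eq_zero_or_eq_last_or_exists_eq i with rfl | rfl | ⟨k, rfl⟩ <;>
    rcases eq_zero_or_eq_last_or_exists_eq j with rfl | rfl | ⟨l, rfl⟩ <;>
    simp only [aVec_zero_index, aVec_last, aVec_fst] at hval
  case inl.inr.inl =>
    have h := hskew 0 (Fin.last (n + 1))
    rw [dual_last, dual_zero] at h
    exact hne (by rw [Matrix.zero_apply]; linarith)
  case inl.inr.inr => exact hne (hrow _)
  case inr.inr.inr.inl =>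
    obtain ⟨l, hl⟩ := exists_dual_eq ‹Fin n›
    rw [hskew, dual_last, hl, hrow l] at hne
    exact hne neg_zero
  all_goals linarith

lemma finrank_rootSpace {α : (ℝ × ℝ) →ₗ[ℝ] ℝ} (hα : 0 < α (1, 0)) :
    Module.finrank ℝ (rootSpace n α) = Nat.card {j : Fin n // rootForm n j = α} := by
  classical
  let firstRow : rootSpace n α →ₗ[ℝ] ({j : Fin n // rootForm n j = α} → ℝ) :=
    { toFun X j := X.1 0 j.1.succ.castSucc
      map_add' _ _ := rfl
      map_smul' _ _ := rfl }
  have hinj : Function.Injective firstRow := by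
    refine (injective_iff_map_eq_zero _).2 fun X hX ↦
      Subtype.ext (eq_zero_of_mem_rootSpace hα X.2 fun j ↦ ?_)
    by_contra hne
    refine hne (congrFun hX ⟨j, LinearMap.ext fun v ↦ ?_⟩)
    have hval := (mul_eq_zero.1 ((mem_rootSpace_iff.1 X.2).2 v 0 _)).resolve_right hne
    rwa [aVec_zero_index, sub_eq_zero] at hval
  have hmem (j : {j : Fin n // rootForm n j = α}) : rootVector j.1 ∈ rootSpace n α := by
    simpa only [j.2] using rootVector_mem_rootSpace j.1
  have hsurj : Function.Surjective firstRow := fun c ↦ by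
    refine ⟨∑ j, c j • ⟨rootVector j.1, hmem j⟩, ?_⟩
    have hterm (j) : firstRow (c j • ⟨rootVector j.1, hmem j⟩) = Pi.single j (c j) := by
      ext k
      rw [map_smul, Pi.smul_apply, smul_eq_mul]
      change c j * rootVector j.1 0 k.1.succ.castSucc = _
      rw [rootVector_zero_apply, Pi.single_apply, Pi.single_apply, mul_ite, mul_one, mul_zero]
      simp only [Subtype.ext_iff]
    rw [map_sum, Finset.sum_congr rfl fun j _ ↦ hterm j]
    exact Finset.univ_sum_single c
  rw [(LinearEquiv.ofBijective firstRow ⟨hinj, hsurj⟩).finrank_eq,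
    Module.finrank_fintype_fun_eq_card, Nat.card_eq_fintype_card]

lemma exists_rootForm_eq {α : (ℝ × ℝ) →ₗ[ℝ] ℝ} (hα : 0 < α (1, 0))
    (hroot : Module.finrank ℝ (rootSpace n α) ≠ 0) : ∃ j, rootForm n j = α := by
  rw [finrank_rootSpace hα] at hroot
  exact nonempty_subtype.1 (Nat.card_ne_zero.1 hroot).1

lemma rho_fst (t : ℝ) : rho n (t, 0) = n * t / 2 := by
  classical
  have hval (α : (ℝ × ℝ) →ₗ[ℝ] ℝ) : α (t, 0) = t * α (1, 0) := by
    rw [← smul_eq_mul, ← map_smul, Prod.smul_mk, smul_zero, smul_eq_mul, mul_one]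
  have hmem : ((1, 0) : ℝ × ℝ) ∈ aplus n := ⟨by simp, fun _ ↦ le_rfl⟩
  have hsum : ∑ α ∈ Finset.univ.image (rootForm n),
      (Module.finrank ℝ (rootSpace n α) : ℝ) * α (t, 0) = n * t := by
    calc ∑ α ∈ Finset.univ.image (rootForm n), (Module.finrank ℝ (rootSpace n α) : ℝ) * α (t, 0)
        = ∑ α ∈ Finset.univ.image (rootForm n), ((Finset.univ.filter (rootForm n · = α)).card : ℝ)
            * t := by
          refine Finset.sum_congr rfl fun α hα ↦ ?_
          obtain ⟨j, -, rfl⟩ := Finset.mem_image.1 hα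
          rw [finrank_rootSpace (by rw [rootForm_fst]; exact one_pos), rootForm_fst,
            Nat.card_eq_fintype_card, Fintype.card_subtype]
      _ = n * t := by
          rw [← Finset.sum_mul, ← Nat.cast_sum, ← Finset.card_eq_sum_card_image,
            Finset.card_univ, Fintype.card_fin]
  rw [rho, finsum_mem_eq_sum_of_inter_support_eq (t := Finset.univ.image (rootForm n)), hsum]
  · ring
  · ext α
    refine and_congr_left fun hne ↦ ⟨fun ⟨_, hnonneg⟩ ↦ ?_, fun hα ↦ ?_⟩
    · rw [Function.mem_support, hval, mul_ne_zero_iff, mul_ne_zero_iff, Nat.cast_ne_zero] at hne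
      obtain ⟨j, hj⟩ := exists_rootForm_eq ((hnonneg _ hmem).lt_of_ne' hne.2.2) hne.1
      simp [← hj]
    · obtain ⟨j, -, rfl⟩ := Finset.mem_image.1 hα
      exact ⟨rootForm_ne_zero j, fun w hw ↦ rootForm_nonneg j hw⟩

/-! ### The growth indicator -/

omit hn in
lemma encard_subgroupOf {S : Type*} [Group S] {Γ L : Subgroup S} (hΓL : Γ ≤ L) (P : S → Prop) :
    {γ | γ ∈ Γ ∧ P γ}.encard = {γ : Γ.subgroupOf L | P (γ : L)}.encard := by
  have hinj : Function.Injective fun γ : Γ.subgroupOf L ↦ ((γ : L) : S) :=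
    Subtype.val_injective.comp Subtype.val_injective
  rw [← hinj.encard_image]
  congr 1
  ext γ
  exact ⟨fun ⟨hγ, hP⟩ ↦ ⟨⟨⟨γ, hΓL hγ⟩, hγ⟩, hP, rfl⟩, fun ⟨δ, hP, hδ⟩ ↦ hδ ▸ ⟨δ.2, hP⟩⟩

omit hn in
lemma log_ofReal_exp_mul_div (s : ℝ) {T : ℝ} (hT : 0 < T) :
    ENNReal.log (ENNReal.ofReal (Real.exp (s * T))) / (T : EReal) = s := by
  rw [ENNReal.log_ofReal_of_pos (Real.exp_pos _), Real.log_exp, ← EReal.coe_div,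
    mul_div_cancel_right₀ s hT.ne']

omit hn in
lemma limsup_log_div_le {f : ℝ → ℝ≥0∞} {c : ℝ}
    (hf : ∀ s, c < s → ∀ᶠ T in atTop, f T ≤ ENNReal.ofReal (Real.exp (s * T))) :
    limsup (fun T : ℝ ↦ ENNReal.log (f T) / (T : EReal)) atTop ≤ c := by
  refine EReal.le_of_forall_lt_iff_le.1 fun s hs ↦ limsup_le_of_le (h := ?_)
  filter_upwards [hf s (EReal.coe_lt_coe_iff.1 hs), eventually_gt_atTop 0] with T hfT hT
  rw [← log_ofReal_exp_mul_div s hT]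
  exact EReal.div_le_div_right_of_nonneg (EReal.coe_nonneg.2 hT.le) (ENNReal.log_le_log hfT)

omit hn in
lemma le_limsup_log_div {f : ℝ → ℝ≥0∞} {c : ℝ}
    (hf : ∀ s < c, ∃ᶠ T in atTop, ENNReal.ofReal (Real.exp (s * T)) ≤ f T) :
    c ≤ limsup (fun T : ℝ ↦ ENNReal.log (f T) / (T : EReal)) atTop := by
  refine EReal.ge_of_forall_gt_iff_ge.1 fun s hs ↦ le_limsup_of_frequently_le ?_
  refine ((hf s (EReal.coe_lt_coe_iff.1 hs)).and_eventually (eventually_gt_atTop 0)).mono ?_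
  rintro T ⟨hfT, hT⟩
  rw [← log_ofReal_exp_mul_div s hT]
  exact EReal.div_le_div_right_of_nonneg (EReal.coe_nonneg.2 hT.le) (ENNReal.log_le_log hfT)

lemma eventually_encard_coshDist_le (Δ : Subgroup (H n)) [DiscreteTopology Δ] {s : ℝ}
    (hs : n - 1 < s) : ∀ᶠ T : ℝ in atTop,
      (({γ : Δ | coshDist n (γ : H n) ≤ Real.cosh T}.encard : ℕ∞) : ℝ≥0∞)
        ≤ ENNReal.ofReal (Real.exp (s * T)) := by
  obtain ⟨A, hA, hcount⟩ := exists_encard_coshDist_le Δ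
  have hlin : (fun T : ℝ ↦ A * (2 * T + 5)) =o[atTop] fun T ↦ Real.exp ((s - (n - 1)) * T) := by
    have h1 := isLittleO_pow_exp_pos_mul_atTop 1 (sub_pos.2 hs)
    have h0 := isLittleO_pow_exp_pos_mul_atTop 0 (sub_pos.2 hs)
    refine (((h1.const_mul_left 2).add (h0.const_mul_left 5)).const_mul_left A).congr_left ?_
    simp
  filter_upwards [hlin.bound one_pos, eventually_ge_atTop 0] with T hbound hT
  refine (hcount T hT).trans (ENNReal.ofReal_le_ofReal ?_)
  rw [one_mul, Real.norm_of_nonneg (by positivity), Real.norm_of_nonneg (Real.exp_pos _).le]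
    at hbound
  calc A * (2 * T + 5) * Real.exp ((n - 1) * T)
      ≤ Real.exp ((s - (n - 1)) * T) * Real.exp ((n - 1) * T) := by gcongr
    _ = Real.exp (s * T) := by rw [← Real.exp_add]; ring_nf

lemma frequently_le_encard_coshDist {Δ : Subgroup (H n)} (hΔ : IsLattice Δ) {s : ℝ}
    (hs : s < n - 1) : ∃ᶠ T : ℝ in atTop, ENNReal.ofReal (Real.exp (s * T)) ≤
      (({γ : Δ | 1 < coshDist n (γ : H n) ∧ coshDist n (γ : H n) ≤ Real.cosh T}.encard : ℕ∞) :
        ℝ≥0∞) := by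
  have := hΔ.1
  obtain ⟨m, hm⟩ := ENat.ne_top_iff_exists.1 (finite_coshDist_le Δ 1).encard_lt_top.ne
  have hs' : max s 0 < n - 1 :=
    max_lt hs (sub_pos.2 (Nat.one_lt_cast.2 hn.prop))
  refine ((frequently_lt_encard_coshDist_le hΔ hs' (1 + m)).and_eventually
    (eventually_ge_atTop 0)).mono ?_
  rintro T ⟨hlt, hT⟩
  refine (lt_of_add_lt_add_right (a := (m : ℝ≥0∞)) ?_).le
  calc ENNReal.ofReal (Real.exp (s * T)) + m
      = ENNReal.ofReal (Real.exp (s * T) + m) := by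
        rw [ENNReal.ofReal_add (Real.exp_pos _).le m.cast_nonneg, ENNReal.ofReal_natCast]
    _ ≤ ENNReal.ofReal ((1 + m) * Real.exp (max s 0 * T)) := by
        rw [add_mul, one_mul]
        gcongr
        · exact le_max_left s 0
        · exact le_mul_of_one_le_right m.cast_nonneg
            (Real.one_le_exp (mul_nonneg (le_max_right s 0) hT))
    _ < _ := hlt
    _ ≤ _ := by
        rw [← ENat.toENNReal_coe m, ← ENat.toENNReal_add, ENat.toENNReal_le, hm]
        refine le_trans (Set.encard_le_encard fun γ hγ ↦ ?_) (Set.encard_union_le _ _)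
        exact (lt_or_ge 1 (coshDist n (γ : H n))).imp (⟨·, hγ⟩) id

/-- The exponential growth rate of `Γ` in a cone `C` with respect to the norm `N` on `𝔞`, of which
the growth indicator takes the infimum over all open cones that contain a given vector. -/
def growthRate (n : ℕ) (N : Seminorm ℝ (ℝ × ℝ))
    (Γ : Subgroup (SpecialLinearGroup (Fin (n + 2)) ℝ)) (C : Set (ℝ × ℝ)) : EReal :=
  limsup (fun T : ℝ ↦
    ENNReal.log (({γ | γ ∈ Γ ∧ cartanProj n γ ∈ C ∧ N (cartanProj n γ) ≤ T}.encard : ℕ∞) : ℝ≥0∞)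
      / (T : EReal)) atTop

omit hn in
lemma growthIndicator_eq (N : Seminorm ℝ (ℝ × ℝ))
    (Γ : Subgroup (SpecialLinearGroup (Fin (n + 2)) ℝ)) (v : ℝ × ℝ) :
    growthIndicator n N Γ v =
      (N v : EReal) * ⨅ (C : Set (ℝ × ℝ)) (_ : IsOpenCone n C ∧ v ∈ C), growthRate n N Γ C :=
  rfl

omit hn in
lemma seminorm_fst (N : Seminorm ℝ (ℝ × ℝ)) {t : ℝ} (ht : 0 ≤ t) : N (t, 0) = t * N (1, 0) := by
  rw [← Real.norm_of_nonneg ht, ← map_smul_eq_mul, Prod.smul_mk, smul_zero, smul_eq_mul, mul_one,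
    Real.norm_of_nonneg ht]

section GrowthRate

variable {Γ : Subgroup (SpecialLinearGroup (Fin (n + 2)) ℝ)} {N : Seminorm ℝ (ℝ × ℝ)}
  {C : Set (ℝ × ℝ)} {v : ℝ × ℝ}

lemma seminorm_cartanProj_le_iff (hN : 0 < N (1, 0)) {h : SpecialLinearGroup (Fin (n + 2)) ℝ}
    (hh : h ∈ H n) {T : ℝ} (hT : 0 ≤ T) :
    N (cartanProj n h) ≤ T * N (1, 0) ↔ coshDist n h ≤ Real.cosh T := by
  have hdist := one_le_coshDist hh
  rw [cartanProj_of_mem_H hh, seminorm_fst N (Real.arcosh_nonneg hdist), mul_le_mul_iff_left₀ hN,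
    ← Real.arcosh_le_arcosh (by linarith) (Real.cosh_pos _), Real.arcosh_cosh hT]

lemma growthRate_le (hΓH : Γ ≤ H n) [DiscreteTopology (Γ.subgroupOf (H n))]
    (hN : 0 < N (1, 0)) (C : Set (ℝ × ℝ)) :
    growthRate n N Γ C ≤ (((n - 1) / N (1, 0) : ℝ) : EReal) := by
  refine limsup_log_div_le fun s hs ↦ ?_
  have hcount := (tendsto_id.atTop_div_const hN).eventually
    (eventually_encard_coshDist_le (Γ.subgroupOf (H n)) ((div_lt_iff₀ hN).1 hs))
  filter_upwards [hcount, eventually_ge_atTop 0] with T hcount hT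
  rw [id, mul_assoc, mul_div_cancel₀ _ hN.ne'] at hcount
  rw [encard_subgroupOf hΓH fun γ ↦ cartanProj n γ ∈ C ∧ N (cartanProj n γ) ≤ T]
  refine (ENat.toENNReal_le.2 (Set.encard_le_encard fun γ hγ ↦ ?_)).trans hcount
  refine (seminorm_cartanProj_le_iff hN (γ : H n).2 (by positivity)).1 ?_
  rw [div_mul_cancel₀ _ hN.ne']
  exact hγ.2

lemma le_growthRate (hΓH : Γ ≤ H n) (hΓ : IsLattice (Γ.subgroupOf (H n))) (hN : 0 < N (1, 0))
    (hC : ∀ s : ℝ, 0 < s → (s, 0) ∈ C) :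
    (((n - 1) / N (1, 0) : ℝ) : EReal) ≤ growthRate n N Γ C := by
  refine le_limsup_log_div fun s hs ↦ (tendsto_id.atTop_mul_const hN).frequently ?_
  refine ((frequently_le_encard_coshDist hΓ ((lt_div_iff₀ hN).1 hs)).and_eventually
    (eventually_ge_atTop 0)).mono ?_
  rintro T ⟨hcount, hT⟩
  rw [id, encard_subgroupOf hΓH fun γ ↦ cartanProj n γ ∈ C ∧ N (cartanProj n γ) ≤ T * N (1, 0),
    mul_left_comm, mul_comm T]
  refine hcount.trans (ENat.toENNReal_le.2 (Set.encard_le_encard fun γ hγ ↦ ⟨?_, ?_⟩))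
  · rw [cartanProj_of_mem_H (γ : H n).2]
    exact hC _ (Real.arcosh_pos hγ.1)
  · exact (seminorm_cartanProj_le_iff hN (γ : H n).2 hT).2 hγ.2

lemma growthRate_eq_bot (hΓH : Γ ≤ H n) (hC : ∀ w ∈ C, w.2 ≠ 0) : growthRate n N Γ C = ⊥ := by
  refine le_bot_iff.1 (limsup_le_of_le (h := ?_))
  filter_upwards [eventually_gt_atTop 0] with T hT
  have hempty : {γ | γ ∈ Γ ∧ cartanProj n γ ∈ C ∧ N (cartanProj n γ) ≤ T} = ∅ :=
    Set.eq_empty_of_forall_notMem fun γ hγ ↦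
      hC _ hγ.2.1 (by rw [cartanProj_of_mem_H (hΓH hγ.1)])
  rw [hempty, Set.encard_empty, ENat.toENNReal_zero, ENNReal.log_zero,
    EReal.bot_div_of_pos_ne_top (EReal.coe_pos.2 hT) (EReal.coe_ne_top _)]

omit hn in
lemma isOpenCone_aplus (n : ℕ) : IsOpenCone n (aplus n) := by
  refine ⟨⟨Set.univ, isOpen_univ, (Set.inter_univ _).symm⟩, fun x hx t ht ↦ ⟨?_, fun h ↦ ?_⟩⟩
  · simpa [abs_mul, abs_of_pos ht] using mul_le_mul_of_nonneg_left hx.1 ht.le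
  · exact mul_nonneg ht.le (hx.2 h)

omit hn in
lemma isOpenCone_aplus_inter_snd_ne_zero (n : ℕ) : IsOpenCone n (aplus n ∩ {w | w.2 ≠ 0}) :=
  ⟨⟨_, isOpen_ne_fun continuous_snd continuous_const, rfl⟩, fun x hx t ht ↦
    ⟨(isOpenCone_aplus n).2 x hx.1 t ht, mul_ne_zero ht.ne' hx.2⟩⟩

theorem growthIndicator_fst (hΓH : Γ ≤ H n) (hΓ : IsLattice (Γ.subgroupOf (H n)))
    (hN : 0 < N (1, 0)) {t : ℝ} (ht : 0 ≤ t) :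
    growthIndicator n N Γ (t, 0) = (((n - 1) * t : ℝ) : EReal) := by
  have := hΓ.1
  rcases ht.eq_or_lt with rfl | ht
  · rw [growthIndicator_eq, seminorm_fst N le_rfl]
    simp
  have hinf : ⨅ (C : Set (ℝ × ℝ)) (_ : IsOpenCone n C ∧ (t, 0) ∈ C), growthRate n N Γ C =
      (((n - 1) / N (1, 0) : ℝ) : EReal) := by
    refine le_antisymm ?_ (le_iInf₂ fun C hC ↦ le_growthRate hΓH hΓ hN fun s hs ↦ ?_)
    · exact (iInf₂_le (aplus n) ⟨isOpenCone_aplus n, by simp [aplus, ht.le]⟩).trans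
        (growthRate_le hΓH hN _)
    · simpa [ht.ne'] using hC.1.2 _ hC.2 (s / t) (by positivity)
  rw [growthIndicator_eq, hinf, ← EReal.coe_mul, seminorm_fst N ht.le]
  congr 1
  field_simp

theorem growthIndicator_eq_bot (hΓH : Γ ≤ H n) (hN : 0 < N v) (hv : v ∈ aplus n)
    (hv' : v ∉ cartanProj n '' (H n : Set (SpecialLinearGroup (Fin (n + 2)) ℝ))) :
    growthIndicator n N Γ v = ⊥ := by
  have hne : v.2 ≠ 0 := fun h ↦
    hv' (by rw [cartanProj_image_H]; exact ⟨(abs_nonneg _).trans hv.1, h⟩)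
  have hinf : ⨅ (C : Set (ℝ × ℝ)) (_ : IsOpenCone n C ∧ v ∈ C), growthRate n N Γ C = ⊥ :=
    le_bot_iff.1 ((iInf₂_le _ ⟨isOpenCone_aplus_inter_snd_ne_zero n, hv, hne⟩).trans
      (growthRate_eq_bot hΓH fun _ hw ↦ hw.2).le)
  rw [growthIndicator_eq, hinf, EReal.coe_mul_bot_of_pos hN]

theorem growthIndicator_eq_rho (hΓH : Γ ≤ H n) (hΓ : IsLattice (Γ.subgroupOf (H n)))
    (hN : 0 < N (1, 0))
    (hv : v ∈ cartanProj n '' (H n : Set (SpecialLinearGroup (Fin (n + 2)) ℝ))) :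
    growthIndicator n N Γ v = ((2 * (n - 1) / n * rho n v : ℝ) : EReal) := by
  rw [cartanProj_image_H] at hv
  obtain ⟨t, s⟩ := v
  obtain ⟨ht, rfl⟩ : 0 ≤ t ∧ s = 0 := hv
  have hn0 : (n : ℝ) ≠ 0 := NeZero.ne _
  rw [growthIndicator_fst hΓH hΓ hN ht, rho_fst]
  congr 1
  field_simp

end GrowthRate

end SOn2

end

theorem mainTheorem9 (n : ℕ) (hn : 2 ≤ n)
    (Γ : Subgroup (Matrix.SpecialLinearGroup (Fin (n + 2)) ℝ))
    (hΓH : Γ ≤ SOn2.H n) (hΓ : SOn2.IsLattice (Γ.subgroupOf (SOn2.H n)))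
    (N : Seminorm ℝ (ℝ × ℝ)) (hN : ∀ v, N v = 0 → v = 0) :
    SOn2.cartanProj n '' (SOn2.H n : Set (Matrix.SpecialLinearGroup (Fin (n + 2)) ℝ))
        = {v | 0 ≤ v.1 ∧ v.2 = 0} ∧
    (∀ t : ℝ, 0 ≤ t →
      SOn2.growthIndicator n N Γ (t, 0) = ((((n : ℝ) - 1) * t : ℝ) : EReal)) ∧
    (∀ v ∈ SOn2.aplus n,
      v ∉ SOn2.cartanProj n '' (SOn2.H n : Set (Matrix.SpecialLinearGroup (Fin (n + 2)) ℝ)) →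
      SOn2.growthIndicator n N Γ v = ⊥) ∧
    (∀ v ∈ SOn2.aplus n,
      SOn2.growthIndicator n N Γ v ≤ ((2 * ((n : ℝ) - 1) / n * SOn2.rho n v : ℝ) : EReal)) ∧
    (∀ v ∈ SOn2.cartanProj n '' (SOn2.H n : Set (Matrix.SpecialLinearGroup (Fin (n + 2)) ℝ)),
      SOn2.growthIndicator n N Γ v = ((2 * ((n : ℝ) - 1) / n * SOn2.rho n v : ℝ) : EReal)) := by
  have : n.AtLeastTwo := ⟨hn⟩
  have hpos (v : ℝ × ℝ) (hv : v ≠ 0) : 0 < N v :=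
    (apply_nonneg N v).lt_of_ne fun h ↦ hv (hN v h.symm)
  have hfst : 0 < N (1, 0) := hpos _ (by simp)
  have himage := SOn2.cartanProj_image_H n
  have hoff : ∀ v ∈ SOn2.aplus n,
      v ∉ SOn2.cartanProj n '' (SOn2.H n : Set (Matrix.SpecialLinearGroup (Fin (n + 2)) ℝ)) →
      SOn2.growthIndicator n N Γ v = ⊥ := fun v hv hv' ↦
    SOn2.growthIndicator_eq_bot hΓH (hpos v fun h ↦ hv' (himage ▸ by simp [h])) hv hv'
  refine ⟨himage, fun t ht ↦ SOn2.growthIndicator_fst hΓH hΓ hfst ht, hoff, fun v hv ↦ ?_,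
    fun v hv ↦ SOn2.growthIndicator_eq_rho hΓH hΓ hfst hv⟩
  by_cases hv' : v ∈ SOn2.cartanProj n '' (SOn2.H n : Set (Matrix.SpecialLinearGroup _ ℝ))
  · exact (SOn2.growthIndicator_eq_rho hΓH hΓ hfst hv').le
  · exact (hoff v hv hv').le.trans bot_le
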